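/- Let $N\ge 3$, $1\le k\le N-2$, let $J_k\subset M=\{1,\dots,N\}$ be a set of exactly $k$ elements, and let $q=(q_j)_{j\in J_k}$ be real numbers with $q_j>1$. For a function $f\in L_2(\mathbb T^N)$, $2\pi$-periodic in each argument ($\mathbb T^N=[-\pi,\pi)^N$ with Lebesgue measure), let $c_\nu(f)=(2\pi)^{-N}\int_{\mathbb T^N}f(x)e^{-i(\nu x)}\,dx$, $\nu\in\mathbb Z^N$, where $(\nu x)=\nu_1x_1+\dots+\nu_Nx_N$, be its Fourier coefficients and, for $n\in\mathbb Z^N$ with $n_j\ge 0$, let $$S_n(x;f)=\sum_{|\nu_1|\le n_1}\dots\sum_{|\nu_N|\le n_N}c_\nu(f)\,e^{i(\nu x)}$$ be its rectangular partial sums. Then there is a constant $C=C(J_k,q)$ (depending on $N$, $J_k$ and $q$ only) with the following property. Let, for each $j\in J_k$, $\{n_j^{(s)}\}_{s=1}^\infty$ be a lacunary sequence of positive integers with $n_j^{(1)}=1$ and $n_j^{(s+1)}/n_j^{(s)}\ge q_j$ for $s=1,2,\dots$. For $\lambda=(\lambda_j)_{j\in J_k}$ and $m=(n_j)_{j\in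 M\setminus J_k}$ with positive integer components, let $n^{(\lambda,m)}\in\mathbb Z^N$ be the vector whose $j$-th component is $n_j^{(\lambda_j)}$ for $j\in J_k$ and $n_j$ for $j\in M\setminus J_k$, and put $W(m)=\prod_{j\in M\setminus J_k}\log(|n_j|+2)$. Then for every $f\in L_2(\mathbb T^N)$ $$\Biggl\|\ \sup_{\lambda_j>0,\ j\in J_k;\ \ n_j>0,\ j\in M\setminus J_k}\frac{|S_{n^{(\lambda,m)}}(x;f)|}{\sqrt{W(m)}}\ \Biggr\|_{L_2(\mathbb T^N)}\le C\,\|f\|_{L_2(\mathbb T^N)} .$$ -/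

import Mathlib

open MeasureTheory
open scoped Real ENNReal

noncomputable section

namespace LacunaryFourier

instance factTwoPiPos : Fact (0 < 2 * π) := ⟨Real.two_pi_pos⟩

/-- The `N`-dimensional torus: functions on it are the functions on `ℝ^N` that are `2π`-periodic in
each argument. Its `volume` is the product of the Lebesgue measures of total mass `2π`. -/
abbrev Torus (N : ℕ) : Type := Fin N → AddCircle (2 * π)

/-- The exponential `e^{i(νx)} = ∏ⱼ e^{i νⱼ xⱼ}`. -/
def expo {N : ℕ} (ν : Fin N → ℤ) (x : Torus N) : ℂ :=
  ∏ j, fourier (ν j) (x j)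

/-- The Fourier coefficient `c_ν(f) = (2π)^{-N} ∫ f(x) e^{-i(νx)} dx`. -/
def coeff {N : ℕ} (f : Torus N → ℂ) (ν : Fin N → ℤ) : ℂ :=
  (((2 * π) ^ N)⁻¹ : ℝ) * ∫ x : Torus N, f x * expo (-ν) x

/-- The rectangular partial sum `S_n(x; f) = ∑_{|ν₁| ≤ n₁} ⋯ ∑_{|ν_N| ≤ n_N} c_ν(f) e^{i(νx)}`. -/
def partialSum {N : ℕ} (n : Fin N → ℕ) (f : Torus N → ℂ) (x : Torus N) : ℂ :=
  ∑ ν ∈ Fintype.piFinset fun j => Finset.Icc (-(n j : ℤ)) (n j : ℤ), coeff f ν * expo ν x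

/-- A sequence `a(1), a(2), …` of positive integers is lacunary with ratio bound `q > 1` if
`a(1) = 1` and `a(s+1) / a(s) ≥ q` for all `s`. -/
structure IsLacunary (q : ℝ) (a : ℕ+ → ℕ+) : Prop where
  one_lt : 1 < q
  map_one : a 1 = 1
  ratio : ∀ s : ℕ+, q ≤ ((a (s + 1) : ℕ) : ℝ) / ((a s : ℕ) : ℝ)

/-- The index vector `n` with `n_j = a_j(l_j)` for `j ∈ J` and `n_j = m_j` (free) for `j ∉ J`. -/
def index {N : ℕ} (J : Finset (Fin N)) (a : J → ℕ+ → ℕ+) (l : J → ℕ+)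
    (m : {j : Fin N // j ∉ J} → ℕ+) (j : Fin N) : ℕ :=
  if h : j ∈ J then (a ⟨j, h⟩ (l ⟨j, h⟩) : ℕ) else (m ⟨j, h⟩ : ℕ)

/-- The weight `W(m) = ∏_{j ∉ J} log(m_j + 2)`. -/
def weight {N : ℕ} {J : Finset (Fin N)} (m : {j : Fin N // j ∉ J} → ℕ+) : ℝ :=
  ∏ j, Real.log (((m j : ℕ) : ℝ) + 2)

/-- The maximal function `sup |S_n(x; f)| / √W(m)` over all lacunary positions `l` and all free
components `m`, with values in `[0, ∞]`. -/
def maximal {N : ℕ} (J : Finset (Fin N)) (a : J → ℕ+ → ℕ+) (f : Torus N → ℂ) (x : Torus N) :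
    ℝ≥0∞ :=
  ⨆ (l : J → ℕ+) (m : {j : Fin N // j ∉ J} → ℕ+),
    ENNReal.ofReal (‖partialSum (index J a l m) f x‖ / √(weight m))

end LacunaryFourier

end

/-! The supremum mixes two kinds of coordinates, each with its own L² mechanism.

In the free coordinates a loss of √log per coordinate is allowed, as in the Kolmogorov–Seliverstov
theorem. The maximizing order n(x) is chosen measurably and T T* is computed for the linearized
operator T. Its kernel is a product Dirichlet kernel of order min(n(x), n(y)), divided by √(W(n(x))
W(n(y))). Because of the minimum, the majorant of either order applies. AM–GM separates x from y,
and the L¹ norm O(W) of the majorant cancels the weight (`lintegral_linearized_le`,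
`maximalBound_boxMultiplier`).

In a lacunary coordinate nothing is lost. A partial sum of order n is the Fejér mean of order n plus
a remainder with multiplier |κ|/(n+1) on |κ| ≤ n. Along a lacunary sequence the squares of these
multipliers have a bounded sum (`sum_sq_fejerRemainder_le`), so the supremum of the remainders is
controlled by a square function. The Fejér means are dominated by positive kernels `bump`. For their
linearized maximal operator T T* ≤ C (T + T*), hence ‖T‖² ≤ 2C‖T‖ and ‖T‖ ≤ 2C
(`lintegral_sq_kernel_le`, `lintegral_iSup_bump_le`).

`MaximalBound` combines the two: it quantifies over arbitrary coefficients, so it survives the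
addition of a lacunary coordinate (`MaximalBound.lacunary`). Remainders only change the
coefficients, while Fejér means average a supremum that is already controlled. The free coordinates,
extended to the whole torus by `MaximalBound.of_subtype`, start an induction over J. Bessel's
inequality and monotone convergence then give the theorem; the constants depend on the ratios q, not
on the sequences. -/

noncomputable section

namespace LacunaryFourier

local notation "𝕋" => AddCircle (2 * π)

/-! ### Exponentials on the torus, Parseval, measurable selection -/

section Exponentials

variable {ι : Type*} [Fintype ι]

/-- The exponential `∏ⱼ e^{i νⱼ xⱼ}` on the torus with an arbitrary finite index type. -/
def mexp (ν : ι → ℤ) (x : ι → 𝕋) : ℂ := ∏ j, fourier (ν j) (x j)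

@[fun_prop]
lemma continuous_mexp (ν : ι → ℤ) : Continuous (mexp ν) := by
  unfold mexp; fun_prop

lemma norm_mexp (ν : ι → ℤ) (x : ι → 𝕋) : ‖mexp ν x‖ = 1 := by
  simp [mexp, fourier_apply, Circle.norm_coe]

lemma mexp_add (ν κ : ι → ℤ) (x : ι → 𝕋) : mexp (ν + κ) x = mexp ν x * mexp κ x := by
  simp only [mexp, Pi.add_apply, fourier_add, Finset.prod_mul_distrib]

lemma mexp_neg (ν : ι → ℤ) (x : ι → 𝕋) : mexp (-ν) x = starRingEnd ℂ (mexp ν x) := by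
  simp only [mexp, Pi.neg_apply, fourier_neg, map_prod]

lemma mexp_sub_arg (ν : ι → ℤ) (x y : ι → 𝕋) :
    mexp ν (x - y) = mexp ν x * starRingEnd ℂ (mexp ν y) := by
  simp only [mexp, Pi.sub_apply, map_prod, ← Finset.prod_mul_distrib]
  refine Finset.prod_congr rfl fun j _ => ?_
  rw [← fourier_neg, fourier_apply, fourier_apply, fourier_apply, smul_sub, sub_eq_add_neg,
    AddCircle.toCircle_add, neg_smul, Circle.coe_mul]

lemma integral_fourier (n : ℤ) : ∫ t : 𝕋, fourier n t = if n = 0 then ((2 * π : ℝ) : ℂ) else 0 := by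
  split_ifs with h
  · subst h
    simp [Measure.real, AddCircle.measure_univ, Real.pi_pos.le]
  · rw [AddCircle.volume_eq_smul_haarAddCircle, integral_smul_measure]
    have h2 := (orthonormal_iff_ite.mp (orthonormal_fourier (T := 2 * π))) 0 n
    rw [ContinuousMap.inner_toLp (μ := AddCircle.haarAddCircle) (𝕜 := ℂ)] at h2
    simp only [fourier_zero, map_one, mul_one, if_neg (Ne.symm h)] at h2
    rw [h2, smul_zero]

lemma integral_mexp (ν : ι → ℤ) :
    ∫ x : ι → 𝕋, mexp ν x = if ν = 0 then (((2 * π) ^ Fintype.card ι : ℝ) : ℂ) else 0 := by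
  unfold mexp
  rw [integral_fintype_prod_volume_eq_prod (fun j (t : 𝕋) => (fourier (ν j) t : ℂ))]
  simp only [integral_fourier]
  split_ifs with h
  · subst h; simp
  · obtain ⟨j, hj⟩ := Function.ne_iff.mp h
    exact Finset.prod_eq_zero (Finset.mem_univ j) (if_neg hj)

lemma integrable_of_continuous_torus {E : Type*} [NormedAddCommGroup E]
    {f : (ι → 𝕋) → E} (hf : Continuous f) : Integrable f :=
  hf.integrable_of_hasCompactSupport (HasCompactSupport.of_compactSpace f)

/-- Parseval's identity for trigonometric polynomials. -/
lemma lintegral_trigPoly {α : Type*} (s : Finset α) {r : α → ι → ℤ} (hr : Set.InjOn r s)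
    (c : α → ℂ) :
    ∫⁻ x : ι → 𝕋, ‖∑ ν ∈ s, c ν * mexp (r ν) x‖ₑ ^ 2 =
      ENNReal.ofReal ((2 * π) ^ Fintype.card ι) * ∑ ν ∈ s, ‖c ν‖ₑ ^ 2 := by
  set f : (ι → 𝕋) → ℂ := fun x => ∑ ν ∈ s, c ν * mexp (r ν) x with hf
  have hfc : Continuous f := by fun_prop
  have h1 : ∫ x, starRingEnd ℂ (f x) * f x =
      (((2 * π) ^ Fintype.card ι * ∑ ν ∈ s, ‖c ν‖ ^ 2 : ℝ) : ℂ) := by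
    have h2 : ∀ x, starRingEnd ℂ (f x) * f x =
        ∑ κ ∈ s, ∑ ν ∈ s, starRingEnd ℂ (c κ) * c ν * mexp (r ν - r κ) x := by
      intro x
      simp only [hf, map_sum, map_mul, Finset.sum_mul_sum, sub_eq_add_neg, mexp_add, mexp_neg]
      refine Finset.sum_congr rfl fun κ _ => Finset.sum_congr rfl fun ν _ => by ring
    simp_rw [h2]
    rw [integral_finsetSum]
    swap
    · intro κ _
      exact integrable_of_continuous_torus (by fun_prop)
    rw [Complex.ofReal_mul, Complex.ofReal_sum, Finset.mul_sum]
    refine Finset.sum_congr rfl fun κ hκ => ?_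
    rw [integral_finsetSum]
    swap
    · intro κ _
      exact integrable_of_continuous_torus (by fun_prop)
    simp_rw [integral_const_mul, integral_mexp, sub_eq_zero]
    rw [Finset.sum_eq_single κ]
    · rw [if_pos rfl, Complex.conj_mul', mul_comm]; norm_cast
    · intro ν hν h; rw [if_neg fun e => h (hr hν hκ e), mul_zero]
    · exact fun h => absurd hκ h
  have h3 : ∫ x, ‖f x‖ ^ 2 = (2 * π) ^ Fintype.card ι * ∑ ν ∈ s, ‖c ν‖ ^ 2 := by
    have : ∀ x, starRingEnd ℂ (f x) * f x = ((‖f x‖ ^ 2 : ℝ) : ℂ) := fun x => by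
      rw [Complex.conj_mul']; norm_cast
    simp_rw [this] at h1
    rw [integral_complex_ofReal] at h1
    exact_mod_cast h1
  have h4 : ∀ z : ℂ, ‖z‖ₑ ^ 2 = ENNReal.ofReal (‖z‖ ^ 2) := fun z => by
    rw [ENNReal.ofReal_pow (norm_nonneg _), ofReal_norm]
  simp only [h4]
  rw [← ofReal_integral_eq_lintegral_ofReal
    (integrable_of_continuous_torus (f := fun x => ‖f x‖ ^ 2) (hfc.norm.pow 2))
    (Filter.Eventually.of_forall fun x => by positivity), h3,
    ENNReal.ofReal_mul (by positivity), ENNReal.ofReal_sum_of_nonneg fun _ _ => by positivity]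

/-- A finite maximum of measurable functions is attained along a measurable selection. -/
lemma exists_measurable_selection {X I : Type*} [MeasurableSpace X] [MeasurableSpace I]
    [DiscreteMeasurableSpace I] [Countable I]
    {g : I → X → ℝ≥0∞} (hg : ∀ i, Measurable (g i)) (s : Finset I) (hs : s.Nonempty) :
    ∃ n : X → I, Measurable n ∧ (∀ x, n x ∈ s) ∧ ∀ x, ⨆ i ∈ s, g i x = g (n x) x := by
  classical
  induction hs using Finset.Nonempty.cons_induction with
  | singleton a => exact ⟨fun _ => a, measurable_const, by simp, by simp⟩
  | cons a s ha hs ih =>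
    obtain ⟨n, hn, hns, hmax⟩ := ih
    have hm : Measurable fun x => g (n x) x :=
      (measurable_from_prod_countable_right (f := fun p : I × X => g p.1 p.2) hg).comp
        (hn.prodMk measurable_id)
    refine ⟨fun x => if g (n x) x ≤ g a x then a else n x,
      Measurable.ite (measurableSet_le hm (hg a)) measurable_const hn, fun x => ?_, fun x => ?_⟩
    · dsimp only; split_ifs <;> simp [hns]
    · rw [Finset.cons_eq_insert, Finset.iSup_insert, hmax]
      dsimp only
      split_ifs with h
      · exact sup_eq_left.mpr h
      · exact sup_eq_right.mpr (not_le.mp h).le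

end Exponentials

/-! ### Dirichlet kernels on the circle -/

lemma exists_coe_eq_abs_le (t : 𝕋) : ∃ x : ℝ, (x : 𝕋) = t ∧ |x| ≤ π := by
  refine ⟨AddCircle.equivIoc (2 * π) (-π) t,
    (AddCircle.equivIoc (2 * π) (-π)).symm_apply_apply t, ?_⟩
  have := (AddCircle.equivIoc (2 * π) (-π) t).2
  rw [abs_le]
  constructor <;> linarith [this.1, this.2]

lemma norm_coe_of_abs_le {x : ℝ} (hx : |x| ≤ π) : ‖(x : 𝕋)‖ = |x| := by
  have hp := Real.pi_pos
  rw [(AddCircle.norm_coe_eq_abs_iff (p := 2 * π) (by positivity)).mpr]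
  rw [abs_of_pos (by positivity : 0 < 2 * π)]
  linarith

/-- This is |e^{ix} − 1| = 2|sin(x/2)| combined with Jordan's inequality. -/
lemma norm_le_norm_fourier_one_sub_one (t : 𝕋) : 2 * ‖t‖ ≤ π * ‖(fourier 1 t : ℂ) - 1‖ := by
  obtain ⟨x, rfl, hx⟩ := exists_coe_eq_abs_le t
  have h1 : (fourier 1 (x : 𝕋) : ℂ) = Complex.exp (Complex.I * x) := by
    rw [fourier_coe_apply]
    congr 1
    push_cast
    field_simp
  rw [norm_coe_of_abs_le hx, h1, Complex.norm_exp_I_mul_ofReal_sub_one, norm_mul, Real.norm_eq_abs,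
    Real.norm_eq_abs, abs_two]
  have := Real.mul_abs_le_abs_sin (x := x / 2) (by rw [abs_div, abs_two]; linarith)
  rw [abs_div, abs_two] at this
  have h2 := mul_le_mul_of_nonneg_left this Real.pi_pos.le
  have h3 : π * (2 / π * (|x| / 2)) = |x| := by field_simp
  linarith

lemma norm_fourier_apply (k : ℤ) (t : 𝕋) : ‖(fourier k t : ℂ)‖ = 1 := by
  simp [fourier_apply, Circle.norm_coe]

lemma fourier_sub_one_mul_sum_Icc (a : ℤ) (n : ℕ) (t : 𝕋) :
    ((fourier 1 t : ℂ) - 1) * ∑ k ∈ Finset.Icc a (a + n), (fourier k t : ℂ) =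
      fourier (a + n + 1) t - fourier a t := by
  induction n with
  | zero =>
    simp only [Nat.cast_zero, add_zero, Finset.Icc_self, Finset.sum_singleton, fourier_add]
    ring
  | succ n ih =>
    have : Finset.Icc a (a + (n + 1 : ℕ)) = insert (a + (n + 1 : ℕ)) (Finset.Icc a (a + n)) := by
      ext k; simp only [Finset.mem_Icc, Finset.mem_insert]; omega
    rw [this, Finset.sum_insert (by simp), mul_add, ih]
    simp only [fourier_add, Nat.cast_add, Nat.cast_one]
    ring

lemma norm_sum_Icc_fourier_le (a : ℤ) (n : ℕ) (t : 𝕋) :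
    ‖∑ k ∈ Finset.Icc a (a + n), (fourier k t : ℂ)‖ ≤ n + 1 := by
  refine (norm_sum_le _ _).trans ?_
  simp only [norm_fourier_apply, Finset.sum_const, Int.card_Icc, nsmul_eq_mul, mul_one]
  have : (a + n + 1 - a).toNat = n + 1 := by omega
  rw [this]; push_cast; rfl

lemma norm_mul_norm_sum_Icc_fourier_le (a : ℤ) (n : ℕ) (t : 𝕋) :
    ‖t‖ * ‖∑ k ∈ Finset.Icc a (a + n), (fourier k t : ℂ)‖ ≤ π := by
  have h1 := norm_le_norm_fourier_one_sub_one t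
  have h2 := congrArg norm (fourier_sub_one_mul_sum_Icc a n t)
  rw [norm_mul] at h2
  have h3 : ‖(fourier (a + n + 1) t : ℂ) - fourier a t‖ ≤ 2 := by
    refine (norm_sub_le _ _).trans ?_
    rw [norm_fourier_apply, norm_fourier_apply]; norm_num
  have h4 := mul_le_mul_of_nonneg_right h1
    (norm_nonneg (∑ k ∈ Finset.Icc a (a + n), (fourier k t : ℂ)))
  rw [mul_assoc, mul_assoc, h2] at h4
  have h5 := mul_le_mul_of_nonneg_left h3 Real.pi_pos.le
  linarith

lemma integral_comp_norm {f : ℝ → ℝ} (hf : Continuous fun x => f |x|) :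
    ∫ t : 𝕋, f ‖t‖ = 2 * ∫ x in (0 : ℝ)..π, f x := by
  rw [← AddCircle.intervalIntegral_preimage (2 * π) (-π) (fun t => f ‖t‖)]
  have h1 : (-π + 2 * π) = π := by ring
  rw [h1]
  have h2 : ∫ x in (-π)..π, f ‖(x : 𝕋)‖ = ∫ x in (-π)..π, f |x| := by
    refine intervalIntegral.integral_congr fun x hx => ?_
    rw [Set.uIcc_of_le (by linarith [Real.pi_pos])] at hx
    simp only [norm_coe_of_abs_le (abs_le.mpr hx)]
  rw [h2, ← intervalIntegral.integral_add_adjacent_intervals (b := 0)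
    (hf.intervalIntegrable _ _) (hf.intervalIntegrable _ _)]
  have h3 : ∫ x in (0 : ℝ)..π, f |x| = ∫ x in (0 : ℝ)..π, f x := by
    refine intervalIntegral.integral_congr fun x hx => ?_
    rw [Set.uIcc_of_le Real.pi_pos.le] at hx
    simp only [abs_of_nonneg hx.1]
  have h4 : ∫ x in (-π)..0, f |x| = ∫ x in (0 : ℝ)..π, f |x| := by
    have := intervalIntegral.integral_comp_neg (fun x => f |x|) (a := 0) (b := π)
    simp only [abs_neg, neg_zero] at this
    exact this.symm
  rw [h4, h3]; ring

lemma integrable_of_continuous_circle {E : Type*} [NormedAddCommGroup E]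
    {f : 𝕋 → E} (hf : Continuous f) : Integrable f :=
  hf.integrable_of_hasCompactSupport (HasCompactSupport.of_compactSpace f)

/-- A majorant of the Dirichlet kernels of order `n` with `2n + 1 ≤ A`. -/
def dirichletMajorant (A : ℝ) (t : 𝕋) : ℝ := 2 * π * A / (π + A * ‖t‖)

lemma continuous_dirichletMajorant {A : ℝ} (hA : 0 ≤ A) : Continuous (dirichletMajorant A) := by
  unfold dirichletMajorant
  refine continuous_const.div (by fun_prop) fun t => ?_
  have := Real.pi_pos
  positivity

lemma dirichletMajorant_nonneg {A : ℝ} (hA : 0 ≤ A) (t : 𝕋) : 0 ≤ dirichletMajorant A t := by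
  unfold dirichletMajorant
  positivity

/-- With A = 2a + 1, the size bound |D| ≤ A multiplied by π and the decay bound |t| |D| ≤ π
multiplied by A add up to (π + A|t|)|D| ≤ 2πA. Only n ≤ a is needed, so one majorant serves all
smaller orders. -/
lemma norm_dirichlet_le {n a : ℕ} (hn : n ≤ a) (t : 𝕋) :
    ‖∑ k ∈ Finset.Icc (-(n : ℤ)) n, (fourier k t : ℂ)‖ ≤ dirichletMajorant (2 * a + 1) t := by
  have h1 := norm_sum_Icc_fourier_le (-(n : ℤ)) (2 * n) t
  have h2 := norm_mul_norm_sum_Icc_fourier_le (-(n : ℤ)) (2 * n) t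
  have h3 : -(n : ℤ) + (2 * n : ℕ) = n := by push_cast; ring
  rw [h3] at h1 h2
  have hn' : (n : ℝ) ≤ a := by exact_mod_cast hn
  push_cast at h1
  have hp := Real.pi_pos
  unfold dirichletMajorant
  rw [le_div_iff₀ (by positivity)]
  have h4 := mul_le_mul_of_nonneg_left h2 (by positivity : (0 : ℝ) ≤ 2 * a + 1)
  have h5 := mul_le_mul_of_nonneg_left (h1.trans (by linarith : 2 * (n : ℝ) + 1 ≤ 2 * a + 1)) hp.le
  linarith

/-- The integral equals 4π log(1 + A), and 1 + A = 2a + 2 ≤ (a + 2)². -/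
lemma integral_dirichletMajorant_le (a : ℕ) :
    ∫ t, dirichletMajorant (2 * a + 1) t ≤ 8 * π * Real.log (a + 2) := by
  have hp := Real.pi_pos
  set A : ℝ := 2 * a + 1 with hA
  have hA0 : 0 < A := by positivity
  have h1 : ∫ t, dirichletMajorant A t = 2 * ∫ x in (0 : ℝ)..π, 2 * π * A / (π + A * x) := by
    refine integral_comp_norm (f := fun x => 2 * π * A / (π + A * x)) ?_
    exact continuous_const.div (by fun_prop) fun x => by positivity
  have h2 : ∫ x in (0 : ℝ)..π, 2 * π * A / (π + A * x) =
      2 * π * Real.log (π + A * π) - 2 * π * Real.log (π + A * 0) := by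
    have hpos : ∀ x ∈ Set.uIcc 0 π, 0 < π + A * x := fun x hx => by
      rw [Set.uIcc_of_le hp.le] at hx
      have := hx.1
      positivity
    refine intervalIntegral.integral_eq_sub_of_hasDerivAt
      (f := fun x => 2 * π * Real.log (π + A * x)) (fun x hx => ?_)
      (ContinuousOn.intervalIntegrable ?_)
    · refine (((((hasDerivAt_id x).const_mul A).const_add π).log
        (hpos x hx).ne').const_mul (2 * π)).congr_deriv ?_
      rw [id, mul_one, mul_div_assoc]
    · exact continuousOn_const.div (by fun_prop) fun x hx => (hpos x hx).ne'
  have h3 : Real.log (π + A * π) = Real.log π + Real.log (1 + A) := by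
    rw [← Real.log_mul hp.ne' (by positivity)]; ring_nf
  have h4 : Real.log (1 + A) ≤ 2 * Real.log (a + 2) := by
    rw [← Real.log_rpow (by positivity)]
    refine Real.log_le_log (by positivity) ?_
    rw [Real.rpow_ofNat]
    nlinarith [(Nat.cast_nonneg a : (0 : ℝ) ≤ a)]
  rw [h1, h2, h3]
  simp only [mul_zero, add_zero]
  nlinarith

/-! ### Bump kernels and the Fejér kernel -/

/-- A radially decreasing approximate identity on the circle, comparable with the Poisson kernel. -/
def bump (A : ℝ) (t : 𝕋) : ℝ≥0∞ := ENNReal.ofReal (A / (1 + A ^ 2 * ‖t‖ ^ 2))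

lemma continuous_bump_real (A : ℝ) : Continuous fun t : 𝕋 => A / (1 + A ^ 2 * ‖t‖ ^ 2) :=
  continuous_const.div (by fun_prop) fun t => by positivity

@[fun_prop]
lemma measurable_bump (A : ℝ) : Measurable (bump A) :=
  (continuous_bump_real A).measurable.ennreal_ofReal

lemma lintegral_bump_le {A : ℝ} (hA : 0 ≤ A) : ∫⁻ t, bump A t ≤ ENNReal.ofReal π := by
  unfold bump
  rw [← ofReal_integral_eq_lintegral_ofReal
    (integrable_of_continuous_circle (continuous_bump_real A))
    (Filter.Eventually.of_forall fun t => by positivity)]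
  refine ENNReal.ofReal_le_ofReal ?_
  have h1 : ∫ t : 𝕋, A / (1 + A ^ 2 * ‖t‖ ^ 2) =
      2 * ∫ x in (0 : ℝ)..π, A / (1 + A ^ 2 * x ^ 2) := by
    refine integral_comp_norm (f := fun x => A / (1 + A ^ 2 * x ^ 2)) ?_
    exact continuous_const.div (by fun_prop) fun x => by positivity
  have h2 : ∫ x in (0 : ℝ)..π, A / (1 + A ^ 2 * x ^ 2) =
      Real.arctan (A * π) - Real.arctan (A * 0) := by
    refine intervalIntegral.integral_eq_sub_of_hasDerivAt
      (f := fun x => Real.arctan (A * x)) (fun x hx => ?_) (Continuous.intervalIntegrable ?_ _ _)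
    · refine ((hasDerivAt_id x).const_mul A).arctan.congr_deriv ?_
      rw [id, mul_one, mul_pow, one_div_mul_eq_div]
    · exact continuous_const.div (by fun_prop) fun x => by positivity
  rw [h1, h2]
  simp only [mul_zero, Real.arctan_zero, sub_zero]
  linarith [Real.arctan_lt_pi_div_two (A * π)]

lemma bump_neg (A : ℝ) (t : 𝕋) : bump A (-t) = bump A t := by simp [bump]

lemma bump_sub_comm (A : ℝ) (x y : 𝕋) : bump A (x - y) = bump A (y - x) := by
  rw [← bump_neg, neg_sub]

lemma bump_le_ofReal {A : ℝ} (hA : 0 ≤ A) (t : 𝕋) : bump A t ≤ ENNReal.ofReal A := by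
  refine ENNReal.ofReal_le_ofReal (div_le_self hA ?_)
  have : 0 ≤ A ^ 2 * ‖t‖ ^ 2 := by positivity
  linarith

lemma bump_le_four_mul {A : ℝ} (hA : 0 ≤ A) {s t : 𝕋} (h : ‖t‖ ≤ 2 * ‖s‖) :
    bump A s ≤ 4 * bump A t := by
  unfold bump
  rw [show (4 : ℝ≥0∞) = ENNReal.ofReal 4 by simp, ← ENNReal.ofReal_mul (by norm_num)]
  refine ENNReal.ofReal_le_ofReal ?_
  rw [← mul_div_assoc, div_le_div_iff₀ (by positivity) (by positivity)]
  have h1 : ‖t‖ ^ 2 ≤ 4 * ‖s‖ ^ 2 := by nlinarith [norm_nonneg t, norm_nonneg s]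
  have h2 := mul_le_mul_of_nonneg_left h1 (by positivity : 0 ≤ A * A ^ 2)
  nlinarith

/-- By the triangle inequality one of x − t, y − t has norm at least ‖x − y‖/2. The corresponding
factor is at most 4 times its value at x − y, and the other factor has integral at most π. This is
the hypothesis T T* ≤ C (T + T*) for kernels whose scale depends on the point. -/
lemma lintegral_bump_mul_bump_le {A B : ℝ} (hA : 0 ≤ A) (hB : 0 ≤ B) (x y : 𝕋) :
    ∫⁻ t, bump A (x - t) * bump B (y - t) ≤
      ENNReal.ofReal (4 * π) * (bump A (x - y) + bump B (x - y)) := by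
  have h1 : ∀ t, bump A (x - t) * bump B (y - t) ≤
      4 * bump A (x - y) * bump B (y - t) + 4 * bump B (x - y) * bump A (x - t) := by
    intro t
    have h : ‖x - y‖ ≤ ‖x - t‖ + ‖y - t‖ := by
      rw [show x - y = (x - t) - (y - t) by abel]; exact norm_sub_le _ _
    rcases le_total ‖x - t‖ ‖y - t‖ with h' | h'
    · refine le_add_left ?_
      rw [mul_comm]
      gcongr
      exact bump_le_four_mul hB (by linarith)
    · refine le_add_right ?_
      gcongr
      exact bump_le_four_mul hA (by linarith)
  refine (lintegral_mono h1).trans ?_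
  rw [lintegral_add_left (by fun_prop), lintegral_const_mul _ (by fun_prop),
    lintegral_const_mul _ (by fun_prop), lintegral_sub_left_eq_self (fun t => bump B t),
    lintegral_sub_left_eq_self (fun t => bump A t), ENNReal.ofReal_mul (by norm_num),
    ENNReal.ofReal_ofNat]
  calc _ ≤ 4 * bump A (x - y) * ENNReal.ofReal π + 4 * bump B (x - y) * ENNReal.ofReal π := by
        gcongr
        · exact lintegral_bump_le hB
        · exact lintegral_bump_le hA
    _ = _ := by ring

/-- The Fejér kernel of order `n`. -/
def fejer (n : ℕ) (t : 𝕋) : ℂ :=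
  ((n + 1 : ℝ)⁻¹ : ℝ) * ∑ k ∈ Finset.Icc (0 : ℤ) n, ∑ l ∈ Finset.Icc (0 : ℤ) n, fourier (k - l) t

@[fun_prop]
lemma continuous_fejer (n : ℕ) : Continuous (fejer n) := by
  unfold fejer; fun_prop

/-- The kernel is |G|²/(n+1) for the geometric sum G, and the bounds |G| ≤ n + 1 and |t| |G| ≤ π are
added after squaring. -/
lemma enorm_fejer_le (n : ℕ) (t : 𝕋) :
    ‖fejer n t‖ₑ ≤ ENNReal.ofReal (1 + π ^ 2) * bump (n + 1) t := by
  have h1 := norm_sum_Icc_fourier_le 0 n t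
  have h2 := norm_mul_norm_sum_Icc_fourier_le 0 n t
  rw [zero_add] at h1 h2
  have h3 : fejer n t = ((n + 1 : ℝ)⁻¹ : ℝ) *
      ((∑ k ∈ Finset.Icc (0 : ℤ) n, fourier k t) *
        starRingEnd ℂ (∑ k ∈ Finset.Icc (0 : ℤ) n, fourier k t)) := by
    simp only [fejer, sub_eq_add_neg, fourier_add, fourier_neg, map_sum, Finset.sum_mul_sum]
  set G := ‖∑ k ∈ Finset.Icc (0 : ℤ) n, (fourier k t : ℂ)‖ with hG
  have hG0 : 0 ≤ G := norm_nonneg _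
  have hA : (0 : ℝ) < n + 1 := by positivity
  have h4 : ‖fejer n t‖ = G ^ 2 / (n + 1) := by
    rw [h3, norm_mul, norm_mul, RCLike.norm_conj, ← hG, Complex.norm_real, Real.norm_eq_abs,
      abs_of_pos (by positivity)]
    field_simp
  unfold bump
  rw [← ENNReal.ofReal_mul (by positivity), ← ofReal_norm, h4]
  refine ENNReal.ofReal_le_ofReal ?_
  rw [← mul_div_assoc, div_le_div_iff₀ hA (by positivity)]
  have h5 : G ^ 2 ≤ (n + 1) ^ 2 := by nlinarith
  have h6 : (‖t‖ * G) ^ 2 ≤ π ^ 2 := by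
    have : 0 ≤ ‖t‖ * G := by positivity
    nlinarith [Real.pi_pos]
  have h7 := mul_le_mul_of_nonneg_left h6 (by positivity : (0 : ℝ) ≤ (n + 1) ^ 2)
  nlinarith

/-- The Fourier multiplier of the Fejér kernel. -/
def fejerMultiplier (n : ℕ) (κ : ℤ) : ℝ := ((n + 1 - |κ|).toNat : ℝ) / (n + 1)

/-- Orthogonality leaves the pairs 0 ≤ k, l ≤ n with k − l = κ, of which there are max(n + 1 − |κ|,
0). The measure is not normalized, whence the factor 2π. -/
lemma integral_fejer_mul_fourier (n : ℕ) (κ : ℤ) (x : 𝕋) :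
    ∫ t, fejer n (x - t) * fourier κ t = (2 * π * fejerMultiplier n κ : ℝ) * fourier κ x := by
  have hsub : ∀ (k : ℤ) (t : 𝕋), (fourier k (x - t) : ℂ) = fourier k x * fourier (-k) t := by
    intro k t
    rw [fourier_apply, fourier_apply, fourier_apply, smul_sub, sub_eq_add_neg,
      AddCircle.toCircle_add, neg_smul, Circle.coe_mul]
  have h1 : ∀ t, fejer n (x - t) * fourier κ t = ∑ k ∈ Finset.Icc (0 : ℤ) n,
      ∑ l ∈ Finset.Icc (0 : ℤ) n, ((n + 1 : ℝ)⁻¹ : ℝ) * (fourier (k - l) x : ℂ) *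
        fourier (κ - (k - l)) t := by
    intro t
    simp only [fejer, hsub, Finset.mul_sum, Finset.sum_mul]
    refine Finset.sum_congr rfl fun k _ => Finset.sum_congr rfl fun l _ => ?_
    rw [show κ - (k - l) = -(k - l) + κ by ring, fourier_add (m := -(k - l))]
    ring
  simp_rw [h1]
  have hint : ∀ k l : ℤ, Integrable fun t : 𝕋 => ((n + 1 : ℝ)⁻¹ : ℝ) * (fourier (k - l) x : ℂ) *
        fourier (κ - (k - l)) t := fun k l => integrable_of_continuous_circle (by fun_prop)
  rw [integral_finsetSum _ fun k _ => integrable_finsetSum _ fun l _ => hint k l]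
  simp_rw [integral_finsetSum _ fun l _ => hint _ l, integral_const_mul, integral_fourier]
  have h2 : ∀ k l : ℤ, ((n + 1 : ℝ)⁻¹ : ℝ) * (fourier (k - l) x : ℂ) *
      (if κ - (k - l) = 0 then ((2 * π : ℝ) : ℂ) else 0) =
      if l = k - κ then ((n + 1 : ℝ)⁻¹ : ℝ) * (fourier κ x : ℂ) * (2 * π : ℝ) else 0 := by
    intro k l
    by_cases h : l = k - κ
    · subst h; simp
    · rw [if_neg h, if_neg (by omega), mul_zero]
  simp_rw [h2, Finset.sum_ite_eq']
  rw [← Finset.sum_filter, Finset.sum_const]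
  have h3 : (Finset.Icc (0 : ℤ) n).filter (fun k => k - κ ∈ Finset.Icc (0 : ℤ) n) =
      Finset.Icc (max 0 κ) (min n (n + κ)) := by
    ext k; simp only [Finset.mem_filter, Finset.mem_Icc]; omega
  rw [h3, Int.card_Icc, fejerMultiplier]
  have h4 : (min (n : ℤ) (n + κ) + 1 - max 0 κ).toNat = (n + 1 - |κ|).toNat := by
    rcases le_total 0 κ with h | h
    · rw [abs_of_nonneg h]; omega
    · rw [abs_of_nonpos h]; omega
  rw [h4, nsmul_eq_mul]
  push_cast
  field_simp

lemma fejerMultiplier_of_lt {n : ℕ} {κ : ℤ} (h : (n : ℤ) < |κ|) : fejerMultiplier n κ = 0 := by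
  have : (n + 1 - |κ|).toNat = 0 := by omega
  simp [fejerMultiplier, this]

lemma one_sub_fejerMultiplier {n : ℕ} {κ : ℤ} (h : |κ| ≤ n) :
    1 - fejerMultiplier n κ = |(κ : ℝ)| / (n + 1) := by
  have h1 : (((n + 1 - |κ|).toNat : ℤ) : ℝ) = ((n + 1 - |κ| : ℤ) : ℝ) := by
    rw [Int.toNat_of_nonneg (by omega)]
  have h2 : (n + 1 : ℝ) ≠ 0 := by positivity
  rw [fejerMultiplier]
  push_cast at h1
  rw [h1]
  field_simp
  ring

/-! ### The Kolmogorov–Seliverstov bound in the free coordinates -/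

section FreePartialSums

variable {ι : Type*} [Fintype ι] {I : Type*}

/-- The family of Fourier multipliers `φ i` has a maximal function that is bounded on `L²`, with
squared constant `C` relative to the `ℓ²` norm of the coefficients. -/
def MaximalBound (φ : I → (ι → ℤ) → ℝ) (C : ℝ≥0∞) : Prop :=
  ∀ (s : Finset I) (Λ : Finset (ι → ℤ)) (c : (ι → ℤ) → ℂ),
    ∫⁻ x, ⨆ i ∈ s, ‖∑ ν ∈ Λ, (φ i ν : ℂ) * c ν * mexp ν x‖ₑ ^ 2 ≤ C * ∑ ν ∈ Λ, ‖c ν‖ₑ ^ 2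

/-- The frequencies `ν` with `|νⱼ| ≤ nⱼ` for all `j`. -/
def box [DecidableEq ι] (n : ι → ℕ) : Finset (ι → ℤ) :=
  Fintype.piFinset fun j => Finset.Icc (-(n j : ℤ)) (n j : ℤ)

/-- The product `∏ⱼ log(nⱼ + 2)`. -/
def logWeight (n : ι → ℕ) : ℝ := ∏ j, Real.log ((n j : ℝ) + 2)

lemma logWeight_pos (n : ι → ℕ) : 0 < logWeight n :=
  Finset.prod_pos fun j _ => Real.log_pos (by
    have : (0 : ℝ) ≤ n j := Nat.cast_nonneg _
    linarith)

/-- The multiplier of the rectangular partial sum of order `n` divided by `√(∏ⱼ log(nⱼ + 2))`. -/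
def boxMultiplier [DecidableEq ι] (n : ι → ℕ) (ν : ι → ℤ) : ℝ :=
  if ν ∈ box n then (√(logWeight n))⁻¹ else 0

/-- A majorant for the product Dirichlet kernels. -/
def boxMajorant (n : ι → ℕ) (z : ι → 𝕋) : ℝ := ∏ j, dirichletMajorant (2 * n j + 1) (z j)

lemma boxMajorant_nonneg (n : ι → ℕ) (z : ι → 𝕋) : 0 ≤ boxMajorant n z :=
  Finset.prod_nonneg fun _ _ => dirichletMajorant_nonneg (by positivity) _

lemma boxMajorant_neg (n : ι → ℕ) (z : ι → 𝕋) : boxMajorant n (-z) = boxMajorant n z := by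
  simp [boxMajorant, dirichletMajorant]

lemma continuous_boxMajorant (n : ι → ℕ) : Continuous (boxMajorant n) :=
  continuous_finsetProd _ fun j _ =>
    (continuous_dirichletMajorant (by positivity)).comp (continuous_apply j)

lemma lintegral_boxMajorant_le (n : ι → ℕ) :
    ∫⁻ z, ENNReal.ofReal (boxMajorant n z) ≤
      ENNReal.ofReal ((8 * π) ^ Fintype.card ι * logWeight n) := by
  rw [← ofReal_integral_eq_lintegral_ofReal
    (integrable_of_continuous_torus (continuous_boxMajorant n))
    (Filter.Eventually.of_forall (boxMajorant_nonneg n))]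
  refine ENNReal.ofReal_le_ofReal ?_
  unfold boxMajorant
  rw [integral_fintype_prod_volume_eq_prod (fun j => dirichletMajorant (2 * n j + 1))]
  calc _ ≤ ∏ j, 8 * π * Real.log (n j + 2) := Finset.prod_le_prod
        (fun j _ => integral_nonneg (dirichletMajorant_nonneg (by positivity)))
        fun j _ => integral_dirichletMajorant_le (n j)
    _ = _ := by simp [Finset.prod_mul_distrib, logWeight, mul_pow]

lemma box_inter_box [DecidableEq ι] (m n : ι → ℕ) : box m ∩ box n = box (m ⊓ n) := by
  ext ν
  simp only [box, Finset.mem_inter, Fintype.mem_piFinset, Finset.mem_Icc, Pi.inf_apply,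
    ← forall_and]
  refine forall_congr' fun j => ?_
  push_cast
  omega

/-- The order m is allowed to be below n because the T T* kernel has order `m ⊓ n`, which must be
compared with the majorant of each of the two orders. -/
lemma norm_sum_box_mexp_le [DecidableEq ι] {m n : ι → ℕ} (h : m ≤ n) (z : ι → 𝕋) :
    ‖∑ ν ∈ box m, mexp ν z‖ ≤ boxMajorant n z := by
  have h1 : ∑ ν ∈ box m, mexp ν z =
      ∏ j, ∑ k ∈ Finset.Icc (-(m j : ℤ)) (m j : ℤ), (fourier k (z j) : ℂ) := by
    rw [Finset.prod_univ_sum]; rfl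
  rw [h1, norm_prod]
  exact Finset.prod_le_prod (fun _ _ => norm_nonneg _) fun j _ => norm_dirichlet_le (h j) (z j)

lemma enorm_sq_eq_ofReal (z : ℂ) : ‖z‖ₑ ^ 2 = ENNReal.ofReal (‖z‖ ^ 2) := by
  rw [ENNReal.ofReal_pow (norm_nonneg _), ofReal_norm]

/-- The `T T*` kernel estimate: the kernel is dominated by each of the two majorants. -/
lemma norm_sum_boxMultiplier_mul_le [DecidableEq ι] (m n : ι → ℕ) {Λ : Finset (ι → ℤ)}
    (hm : box m ⊆ Λ) (x y : ι → 𝕋) (a b : ℝ) :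
    a * b * ‖∑ ν ∈ Λ, (boxMultiplier m ν * boxMultiplier n ν : ℂ) *
      (mexp ν x * starRingEnd ℂ (mexp ν y))‖ ≤
      a ^ 2 / 2 * (logWeight m)⁻¹ * boxMajorant m (x - y) +
        b ^ 2 / 2 * (logWeight n)⁻¹ * boxMajorant n (x - y) := by
  set u := (√(logWeight m))⁻¹ with hu
  set v := (√(logWeight n))⁻¹ with hv
  have hu0 : 0 ≤ u := by positivity
  have hv0 : 0 ≤ v := by positivity
  have hu2 : (logWeight m)⁻¹ = u ^ 2 := by
    rw [hu, inv_pow, Real.sq_sqrt (logWeight_pos m).le]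
  have hv2 : (logWeight n)⁻¹ = v ^ 2 := by
    rw [hv, inv_pow, Real.sq_sqrt (logWeight_pos n).le]
  have h1 : ∑ ν ∈ Λ, (boxMultiplier m ν * boxMultiplier n ν : ℂ) *
      (mexp ν x * starRingEnd ℂ (mexp ν y)) = (u * v : ℂ) * ∑ ν ∈ box (m ⊓ n), mexp ν (x - y) := by
    rw [← box_inter_box, Finset.mul_sum,
      ← Finset.sum_subset (Finset.inter_subset_left.trans hm) (s₁ := box m ∩ box n)]
    · refine Finset.sum_congr rfl fun ν hν => ?_
      rw [Finset.mem_inter] at hν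
      rw [boxMultiplier, boxMultiplier, if_pos hν.1, if_pos hν.2, mexp_sub_arg]
    · intro ν _ hν
      rw [Finset.mem_inter, not_and_or] at hν
      rcases hν with h | h <;> simp [boxMultiplier, h]
  rw [h1, hu2, hv2, norm_mul, norm_mul, Complex.norm_real, Complex.norm_real, Real.norm_eq_abs,
    Real.norm_eq_abs, abs_of_nonneg hu0, abs_of_nonneg hv0]
  set D := ‖∑ ν ∈ box (m ⊓ n), mexp ν (x - y)‖
  have hD : 0 ≤ D := norm_nonneg _
  have h2 : D ≤ boxMajorant m (x - y) := norm_sum_box_mexp_le inf_le_left _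
  have h3 : D ≤ boxMajorant n (x - y) := norm_sum_box_mexp_le inf_le_right _
  have h4 := mul_le_mul_of_nonneg_left h2 (by positivity : 0 ≤ a ^ 2 / 2 * u ^ 2)
  have h5 := mul_le_mul_of_nonneg_left h3 (by positivity : 0 ≤ b ^ 2 / 2 * v ^ 2)
  -- AM–GM: a u b v D ≤ (a²u² + b²v²) D / 2. Each of the two terms then uses its own majorant of D.
  have h6 := mul_nonneg (sq_nonneg (a * u - b * v)) hD
  linarith

/-- The `L²` bound for a linearized maximal operator, by the `T T*` method. -/
lemma lintegral_linearized_le [DecidableEq ι] [Countable I] [MeasurableSpace I]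
    [DiscreteMeasurableSpace I] (M : I → ι → ℕ) (s : Finset I) (Λ : Finset (ι → ℤ))
    (c : (ι → ℤ) → ℂ) {n : (ι → 𝕋) → I} (hn : Measurable n) (hs : ∀ x, n x ∈ s) :
    ∫⁻ x, ‖∑ ν ∈ Λ, (boxMultiplier (M (n x)) ν : ℂ) * c ν * mexp ν x‖ₑ ^ 2 ≤
      ENNReal.ofReal ((8 * π) ^ Fintype.card ι) * ∑ ν ∈ Λ, ‖c ν‖ₑ ^ 2 := by
  set φ : (ι → 𝕋) → (ι → ℤ) → ℝ := fun x ν => boxMultiplier (M (n x)) ν with hφ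
  have hφm : ∀ ν, Measurable fun x => φ x ν := fun ν =>
    (Measurable.of_discrete (f := fun i => boxMultiplier (M i) ν)).comp hn
  obtain ⟨B, hB0, hB⟩ : ∃ B : ℝ, 0 ≤ B ∧ ∀ x ν, |φ x ν| ≤ B := by
    refine ⟨∑ i ∈ s, (√(logWeight (M i)))⁻¹, by positivity, fun x ν => ?_⟩
    have h1 : (√(logWeight (M (n x))))⁻¹ ≤ ∑ i ∈ s, (√(logWeight (M i)))⁻¹ :=
      Finset.single_le_sum (f := fun i => (√(logWeight (M i)))⁻¹) (fun i _ => by positivity) (hs x)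
    refine le_trans ?_ h1
    simp only [hφ, boxMultiplier]
    split_ifs
    · rw [abs_of_nonneg (by positivity)]
    · rw [abs_zero]; positivity
  set h : (ι → 𝕋) → ℂ := fun x => ∑ ν ∈ Λ, (φ x ν : ℂ) * c ν * mexp ν x with hh
  have hem : ∀ ν : ι → ℤ, Measurable (mexp ν) := fun ν => (continuous_mexp ν).measurable
  have hhm : Measurable h := by
    refine Finset.measurable_fun_sum _ fun ν _ => ?_
    exact ((Complex.measurable_ofReal.comp (hφm ν)).mul_const _).mul (hem ν)
  obtain ⟨B', hB'⟩ : ∃ B', ∀ x, ‖h x‖ ≤ B' := by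
    refine ⟨∑ ν ∈ Λ, B * ‖c ν‖, fun x => (norm_sum_le _ _).trans
      (Finset.sum_le_sum fun ν _ => ?_)⟩
    rw [norm_mul, norm_mul, norm_mexp, mul_one, Complex.norm_real]
    exact mul_le_mul_of_nonneg_right (hB x ν) (norm_nonneg _)
  have hB'0 : 0 ≤ B' := (norm_nonneg _).trans (hB' 0)
  set u : (ι → ℤ) → (ι → 𝕋) → ℂ := fun ν x => starRingEnd ℂ (h x) * (φ x ν * mexp ν x) with hu
  have hum : ∀ ν, Measurable (u ν) := fun ν =>
    (Complex.continuous_conj.measurable.comp hhm).mul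
      ((Complex.measurable_ofReal.comp (hφm ν)).mul (hem ν))
  have hui : ∀ ν, Integrable (u ν) := fun ν => by
    refine Integrable.of_bound (hum ν).aestronglyMeasurable (B' * B)
      (Filter.Eventually.of_forall fun x => ?_)
    rw [hu, norm_mul, norm_mul, norm_mexp, mul_one, Complex.norm_real, RCLike.norm_conj]
    exact mul_le_mul (hB' x) (hB x ν) (abs_nonneg _) hB'0
  -- Up to conjugation this is the adjoint of the linearized operator applied to h.
  set a : (ι → ℤ) → ℂ := fun ν => ∫ x, u ν x with ha
  set H : ℝ := ∫ x, ‖h x‖ ^ 2 with hH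
  have hHi : Integrable fun x => ‖h x‖ ^ 2 := by
    refine Integrable.of_bound (hhm.norm.pow_const 2).aestronglyMeasurable (B' ^ 2)
      (Filter.Eventually.of_forall fun x => ?_)
    rw [norm_pow, norm_norm]
    exact pow_le_pow_left₀ (norm_nonneg _) (hB' x) 2
  have hH0 : 0 ≤ H := integral_nonneg fun x => by positivity
  have hHa : (H : ℂ) = ∑ ν ∈ Λ, c ν * a ν := by
    simp only [ha, ← integral_const_mul]
    rw [← integral_finsetSum _ fun ν _ => (hui ν).const_mul _, hH, ← integral_complex_ofReal]
    refine integral_congr_ae (Filter.Eventually.of_forall fun x => ?_)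
    simp only [Complex.ofReal_pow, ← Complex.conj_mul']
    nth_rw 2 [hh]
    simp only [hu, Finset.mul_sum]
    exact Finset.sum_congr rfl fun ν _ => by ring
  set K : ℝ := (8 * π) ^ Fintype.card ι with hK
  have hK0 : 0 ≤ K := by positivity
  -- Enlarging Λ to contain every box that can be selected makes the T T* kernel a complete
  -- Dirichlet kernel, which a truncation to Λ would not be.
  set Λ' := Λ ∪ s.biUnion fun i => box (M i) with hΛ'
  have hΛs : ∀ i ∈ s, box (M i) ⊆ Λ' := fun i hi =>
    (Finset.subset_biUnion_of_mem (fun i => box (M i)) hi).trans Finset.subset_union_right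
  have haK : ∑ ν ∈ Λ', ‖a ν‖ ^ 2 ≤ K * H := by
    set F : (ι → 𝕋) × (ι → 𝕋) → ℂ := fun p => ∑ ν ∈ Λ', u ν p.1 * starRingEnd ℂ (u ν p.2) with hF
    have hFint : ((∑ ν ∈ Λ', ‖a ν‖ ^ 2 : ℝ) : ℂ) = ∫ p, F p := by
      rw [hF, integral_finsetSum]
      · rw [Complex.ofReal_sum]
        refine Finset.sum_congr rfl fun ν _ => ?_
        rw [Measure.volume_eq_prod, integral_prod_mul (u ν) fun y => starRingEnd ℂ (u ν y),
          integral_conj, Complex.mul_conj', Complex.ofReal_pow]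
      · intro ν _
        exact (hui ν).mul_prod ((hui ν).mono
          (Complex.continuous_conj.measurable.comp (hum ν)).aestronglyMeasurable (by simp))
    set Ψ : (ι → 𝕋) × (ι → 𝕋) → ℝ≥0∞ := fun p => ENNReal.ofReal (‖h p.1‖ ^ 2 / 2 *
      (logWeight (M (n p.1)))⁻¹) * ENNReal.ofReal (boxMajorant (M (n p.1)) (p.1 - p.2)) with hΨ
    have hw0 : ∀ x, 0 ≤ (logWeight (M (n x)))⁻¹ := fun x => (inv_pos.mpr (logWeight_pos _)).le
    have hwm : Measurable fun x => ENNReal.ofReal (‖h x‖ ^ 2 / 2 * (logWeight (M (n x)))⁻¹) :=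
      (((hhm.norm.pow_const 2).div_const 2).mul
        ((Measurable.of_discrete (f := fun i => (logWeight (M i))⁻¹)).comp hn)).ennreal_ofReal
    have hΨm : Measurable Ψ := by
      refine (hwm.comp measurable_fst).mul ?_
      exact ((measurable_from_prod_countable_right
        (f := fun p : I × (ι → 𝕋) => boxMajorant (M p.1) p.2)
        fun i => (continuous_boxMajorant (M i)).measurable).comp
        ((hn.comp measurable_fst).prodMk (measurable_fst.sub measurable_snd))).ennreal_ofReal
    have hFΨ : ∀ p, ‖F p‖ₑ ≤ Ψ p + Ψ p.swap := by
      rintro ⟨x, y⟩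
      have h1 : F (x, y) = starRingEnd ℂ (h x) * h y *
          ∑ ν ∈ Λ', (φ x ν * φ y ν : ℂ) * (mexp ν x * starRingEnd ℂ (mexp ν y)) := by
        simp only [hF, hu, map_mul, Complex.conj_conj, Complex.conj_ofReal, Finset.mul_sum]
        exact Finset.sum_congr rfl fun ν _ => by ring
      simp only [hΨ, Prod.swap_prod_mk]
      rw [← ENNReal.ofReal_mul (mul_nonneg (by positivity) (hw0 x)),
        ← ENNReal.ofReal_mul (mul_nonneg (by positivity) (hw0 y)),
        ← ENNReal.ofReal_add
          (mul_nonneg (mul_nonneg (by positivity) (hw0 x)) (boxMajorant_nonneg _ _))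
          (mul_nonneg (mul_nonneg (by positivity) (hw0 y)) (boxMajorant_nonneg _ _)),
        ← ofReal_norm, h1, norm_mul, norm_mul, RCLike.norm_conj, ← neg_sub x y, boxMajorant_neg]
      exact ENNReal.ofReal_le_ofReal
        (norm_sum_boxMultiplier_mul_le _ _ (hΛs _ (hs x)) x y ‖h x‖ ‖h y‖)
    -- Integrating in y first keeps n(x) fixed, so the L¹ norm of the majorant, at most K times the
    -- weight at n(x), cancels the inverse weight.
    have hΨint : ∫⁻ x, ∫⁻ y, Ψ (x, y) ≤ ENNReal.ofReal (K / 2 * H) := by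
      rw [ENNReal.ofReal_mul (by positivity), hH,
        ofReal_integral_eq_lintegral_ofReal hHi
          (Filter.Eventually.of_forall fun x => by positivity),
        ← lintegral_const_mul _ (hhm.norm.pow_const 2).ennreal_ofReal]
      refine lintegral_mono fun x => ?_
      have hbm : Measurable fun y => ENNReal.ofReal (boxMajorant (M (n x)) (x - y)) :=
        ((continuous_boxMajorant _).measurable.comp
          (measurable_const.sub measurable_id)).ennreal_ofReal
      simp only [hΨ]
      rw [lintegral_const_mul _ hbm]
      simp only [fun y => (neg_sub y x ▸ boxMajorant_neg (M (n x)) (y - x) :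
        boxMajorant (M (n x)) (x - y) = boxMajorant (M (n x)) (y - x))]
      rw [lintegral_sub_right_eq_self fun z => ENNReal.ofReal (boxMajorant (M (n x)) z)]
      refine (mul_le_mul_right (lintegral_boxMajorant_le _) _).trans ?_
      rw [← ENNReal.ofReal_mul (mul_nonneg (by positivity) (hw0 x)),
        ← ENNReal.ofReal_mul (by positivity)]
      refine ENNReal.ofReal_le_ofReal (le_of_eq ?_)
      have := (logWeight_pos (M (n x))).ne'
      rw [← hK]
      field_simp
    have h2 : ENNReal.ofReal (∑ ν ∈ Λ', ‖a ν‖ ^ 2) ≤ ENNReal.ofReal (K * H) := by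
      have h3 : ENNReal.ofReal (∑ ν ∈ Λ', ‖a ν‖ ^ 2) = ‖∫ p, F p‖ₑ := by
        rw [← hFint, ← ofReal_norm, Complex.norm_real, Real.norm_of_nonneg (by positivity)]
      rw [h3]
      refine (enorm_integral_le_lintegral_enorm _).trans ((lintegral_mono hFΨ).trans ?_)
      rw [lintegral_add_left hΨm, Measure.volume_eq_prod, lintegral_prod _ hΨm.aemeasurable,
        lintegral_prod_symm (f := fun p => Ψ p.swap) (hΨm.comp measurable_swap).aemeasurable,
        show K * H = K / 2 * H + K / 2 * H by ring,
        ENNReal.ofReal_add (by positivity) (by positivity)]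
      exact add_le_add hΨint hΨint
    exact (ENNReal.ofReal_le_ofReal_iff (by positivity)).mp h2
  have hfin : H ≤ K * ∑ ν ∈ Λ, ‖c ν‖ ^ 2 := by
    set S := ∑ ν ∈ Λ, ‖c ν‖ ^ 2 with hS
    have hS0 : 0 ≤ S := by positivity
    have h1 : H ≤ ∑ ν ∈ Λ, ‖c ν‖ * ‖a ν‖ := by
      have := congrArg norm hHa
      rw [Complex.norm_real, Real.norm_of_nonneg hH0] at this
      rw [this]
      refine (norm_sum_le _ _).trans_eq (Finset.sum_congr rfl fun ν _ => norm_mul _ _)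
    have h2 := Finset.sum_mul_sq_le_sq_mul_sq Λ (fun ν => ‖c ν‖) (fun ν => ‖a ν‖)
    have h3 : ∑ ν ∈ Λ, ‖a ν‖ ^ 2 ≤ K * H :=
      (Finset.sum_le_sum_of_subset_of_nonneg Finset.subset_union_left
        fun _ _ _ => by positivity).trans haK
    have h4 : H ^ 2 ≤ S * (K * H) :=
      (pow_le_pow_left₀ hH0 h1 2).trans (h2.trans (mul_le_mul_of_nonneg_left h3 hS0))
    rcases hH0.eq_or_lt with h0 | h0
    · rw [← h0]; positivity
    · have : H * H ≤ (K * S) * H := by nlinarith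
      exact le_of_mul_le_mul_right this h0
  simp only [enorm_sq_eq_ofReal]
  rw [← ofReal_integral_eq_lintegral_ofReal hHi
      (Filter.Eventually.of_forall fun x => by positivity),
    ← ENNReal.ofReal_sum_of_nonneg fun _ _ => by positivity, ← ENNReal.ofReal_mul hK0]
  exact ENNReal.ofReal_le_ofReal hfin

/-- The Kolmogorov–Seliverstov theorem for rectangular partial sums of multiple Fourier series. -/
lemma maximalBound_boxMultiplier [DecidableEq ι] [Countable I] (M : I → ι → ℕ) :
    MaximalBound (fun i => boxMultiplier (M i)) (ENNReal.ofReal ((8 * π) ^ Fintype.card ι)) := by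
  intro s Λ c
  rcases s.eq_empty_or_nonempty with rfl | hs
  · simp
  let _ : MeasurableSpace I := ⊤
  have _ : DiscreteMeasurableSpace I := ⟨fun _ => trivial⟩
  obtain ⟨n, hn, hns, hmax⟩ := exists_measurable_selection (g := fun i (x : ι → 𝕋) =>
    ‖∑ ν ∈ Λ, (boxMultiplier (M i) ν : ℂ) * c ν * mexp ν x‖ₑ ^ 2)
    (fun i => by
      have : Continuous fun x : ι → 𝕋 => ∑ ν ∈ Λ, (boxMultiplier (M i) ν : ℂ) * c ν * mexp ν x := by
        fun_prop
      exact this.measurable.enorm.pow_const 2) s hs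
  simp_rw [hmax]
  exact lintegral_linearized_le M s Λ c hn hns

end FreePartialSums

/-! ### L² bounds for positive kernels -/

section PositiveKernel

variable {X : Type*} [MeasurableSpace X] {μ : Measure X}

/-- The Cauchy–Schwarz inequality for the Lebesgue integral. -/
lemma sq_lintegral_mul_le {f g : X → ℝ≥0∞} (hf : AEMeasurable f μ)
    (hg : AEMeasurable g μ) :
    (∫⁻ x, f x * g x ∂μ) ^ 2 ≤ (∫⁻ x, f x ^ 2 ∂μ) * ∫⁻ x, g x ^ 2 ∂μ := by
  have h := ENNReal.lintegral_mul_le_Lp_mul_Lq μ Real.HolderConjugate.two_two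
    hf hg
  have hsq : ∀ a : ℝ≥0∞, (a ^ (1 / 2 : ℝ)) ^ 2 = a := fun a => by
    rw [← ENNReal.rpow_natCast, ← ENNReal.rpow_mul]; norm_num
  have h2 := pow_le_pow_left₀ (zero_le) h 2
  rw [mul_pow, hsq, hsq] at h2
  simpa using h2

variable [SFinite μ]

lemma lintegral_mul_lintegral_kernel {k : X → X → ℝ≥0∞} (hk : Measurable (Function.uncurry k))
    {u v : X → ℝ≥0∞} (hu : Measurable u) (hv : Measurable v) :
    ∫⁻ x, u x * ∫⁻ t, k x t * v t ∂μ ∂μ = ∫⁻ t, v t * ∫⁻ x, k x t * u x ∂μ ∂μ := by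
  have h1 : ∀ x, u x * ∫⁻ t, k x t * v t ∂μ = ∫⁻ t, u x * (k x t * v t) ∂μ := fun x =>
    (lintegral_const_mul _ ((hk.comp measurable_prodMk_left).mul hv)).symm
  have h2 : ∀ t, v t * ∫⁻ x, k x t * u x ∂μ = ∫⁻ x, u x * (k x t * v t) ∂μ := fun t => by
    have hkt : Measurable fun x => k x t * u x := (hk.comp measurable_prodMk_right).mul hu
    rw [← lintegral_const_mul _ hkt]
    exact lintegral_congr fun x => by ring
  simp_rw [h1, h2]
  refine lintegral_lintegral_swap (Measurable.aemeasurable ?_)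
  exact (hu.comp measurable_fst).mul (hk.mul (hv.comp measurable_snd))

/-- One step of the bootstrap in the `T T*` argument for positive kernels. -/
lemma sq_lintegral_kernel_le {k : X → X → ℝ≥0∞} (hk : Measurable (Function.uncurry k)) {C : ℝ≥0∞}
    (hC : ∀ x y, ∫⁻ t, k x t * k y t ∂μ ≤ C * (k x y + k y x)) {a : ℝ≥0∞}
    (ha : ∀ g : X → ℝ≥0∞, Measurable g → ∫⁻ x, g x ^ 2 ∂μ ≠ ∞ →
      ∫⁻ x, (∫⁻ t, k x t * g t ∂μ) ^ 2 ∂μ ≤ a * ∫⁻ x, g x ^ 2 ∂μ) (hatop : a ≠ ∞)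
    {g : X → ℝ≥0∞} (hg : Measurable g) (hgtop : ∫⁻ x, g x ^ 2 ∂μ ≠ ∞) :
    (∫⁻ x, (∫⁻ t, k x t * g t ∂μ) ^ 2 ∂μ) ^ 2 ≤ (2 * C) ^ 2 * a * (∫⁻ x, g x ^ 2 ∂μ) ^ 2 := by
  have hk' : Measurable (Function.uncurry fun x y => k y x) := hk.comp measurable_swap
  have hT : ∀ g : X → ℝ≥0∞, Measurable g → Measurable fun x => ∫⁻ t, k x t * g t ∂μ := fun g hg =>
    Measurable.lintegral_prod_right' (f := fun p : X × X => k p.1 p.2 * g p.2)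
      (hk.mul (hg.comp measurable_snd))
  have hT' : ∀ g : X → ℝ≥0∞, Measurable g → Measurable fun t => ∫⁻ x, k x t * g x ∂μ := fun g hg =>
    Measurable.lintegral_prod_right' (f := fun p : X × X => k p.2 p.1 * g p.2)
      (hk'.mul (hg.comp measurable_snd))
  set h : X → ℝ≥0∞ := fun x => ∫⁻ t, k x t * g t ∂μ with hh
  have hhm : Measurable h := hT g hg
  set w : X → ℝ≥0∞ := fun t => ∫⁻ x, k x t * h x ∂μ with hw
  have hwm : Measurable w := hT' h hhm
  set G := ∫⁻ x, g x ^ 2 ∂μ with hG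
  set H := ∫⁻ x, h x ^ 2 ∂μ with hH
  set Q := ∫⁻ x, w x ^ 2 ∂μ with hQ
  have hHle : H ≤ a * G := ha g hg hgtop
  have hHtop : H ≠ ∞ := ne_top_of_le_ne_top (ENNReal.mul_ne_top hatop hgtop) hHle
  have h1 : H ^ 2 ≤ G * Q := by
    have : H = ∫⁻ t, g t * w t ∂μ := by
      rw [hH, hw, ← lintegral_mul_lintegral_kernel hk hhm hg]
      exact lintegral_congr fun x => sq _
    rw [this]
    exact sq_lintegral_mul_le hg.aemeasurable hwm.aemeasurable
  -- With T the operator of kernel k, Q = ⟨h, T T* h⟩ ≤ C ⟨h, (T + T*) h⟩ = 2C ⟨h, T h⟩.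
  have h2 : Q ≤ 2 * C * ∫⁻ x, h x * ∫⁻ t, k x t * h t ∂μ ∂μ := by
    calc Q = ∫⁻ x, h x * ∫⁻ t, k x t * w t ∂μ ∂μ := by
          rw [hQ, lintegral_mul_lintegral_kernel hk hhm hwm]
          exact lintegral_congr fun x => sq _
      _ ≤ ∫⁻ x, h x * ∫⁻ y, h y * (C * (k x y + k y x)) ∂μ ∂μ := by
          refine lintegral_mono fun x => ?_
          refine mul_le_mul_right ?_ _
          rw [hw, lintegral_mul_lintegral_kernel hk' (u := k x)
            (hk.comp measurable_prodMk_left) hhm]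
          refine lintegral_mono fun y => ?_
          refine mul_le_mul_right ?_ _
          refine (le_of_eq (lintegral_congr fun t => mul_comm _ _)).trans (hC x y)
      _ = ∫⁻ x, (C * (h x * ∫⁻ y, k x y * h y ∂μ) + C * (h x * ∫⁻ y, k y x * h y ∂μ)) ∂μ := by
          refine lintegral_congr fun x => ?_
          have : ∀ y, h y * (C * (k x y + k y x)) = C * (k x y * h y) + C * (k y x * h y) :=
            fun y => by ring
          simp_rw [this]
          have hx1 : Measurable fun y => k x y * h y :=
            (hk.comp (measurable_prodMk_left (x := x))).mul hhm
          have hx2 : Measurable fun y => k y x * h y :=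
            (hk.comp (measurable_prodMk_right (y := x))).mul hhm
          rw [lintegral_add_left (hx1.const_mul C), lintegral_const_mul _ hx1,
            lintegral_const_mul _ hx2]
          ring
      _ = _ := by
          have hm1 : Measurable fun x => h x * ∫⁻ y, k x y * h y ∂μ := hhm.mul (hT h hhm)
          have hm2 : Measurable fun x => h x * ∫⁻ y, k y x * h y ∂μ := hhm.mul (hT' h hhm)
          rw [lintegral_add_left (hm1.const_mul C), lintegral_const_mul _ hm1,
            lintegral_const_mul _ hm2, ← lintegral_mul_lintegral_kernel hk hhm hhm]
          ring
  have h3 : (∫⁻ x, h x * ∫⁻ t, k x t * h t ∂μ ∂μ) ^ 2 ≤ H * (a * H) :=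
    (sq_lintegral_mul_le hhm.aemeasurable (hT h hhm).aemeasurable).trans
      (mul_le_mul_right (ha h hhm hHtop) _)
  have h4 : H ^ 2 * H ^ 2 ≤ (2 * C) ^ 2 * a * G ^ 2 * H ^ 2 :=
    calc H ^ 2 * H ^ 2 ≤ (G * Q) * (G * Q) := by gcongr
      _ = G ^ 2 * Q ^ 2 := by ring
      _ ≤ G ^ 2 * (2 * C * ∫⁻ x, h x * ∫⁻ t, k x t * h t ∂μ ∂μ) ^ 2 := by gcongr
      _ = G ^ 2 * ((2 * C) ^ 2 * (∫⁻ x, h x * ∫⁻ t, k x t * h t ∂μ ∂μ) ^ 2) := by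
          rw [mul_pow]
      _ ≤ G ^ 2 * ((2 * C) ^ 2 * (H * (a * H))) := by gcongr
      _ = _ := by ring
  rcases eq_or_ne H 0 with h0 | h0
  · rw [h0]; simp
  · exact (ENNReal.mul_le_mul_iff_left (pow_ne_zero 2 h0) (ENNReal.pow_ne_top hHtop)).mp h4

/-- A bounded positive kernel `k` with `∫ k(x,t) k(y,t) dt ≤ C (k(x,y) + k(y,x))` is bounded on
`L²` with norm at most `2 C`. -/
lemma lintegral_sq_kernel_le [IsFiniteMeasure μ] {k : X → X → ℝ≥0∞}
    (hk : Measurable (Function.uncurry k)) {C : ℝ≥0∞}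
    (hC : ∀ x y, ∫⁻ t, k x t * k y t ∂μ ≤ C * (k x y + k y x))
    {B : ℝ≥0∞} (hB : ∀ x y, k x y ≤ B) (hBtop : B ≠ ∞)
    {g : X → ℝ≥0∞} (hg : Measurable g) (hgtop : ∫⁻ x, g x ^ 2 ∂μ ≠ ∞) :
    ∫⁻ x, (∫⁻ t, k x t * g t ∂μ) ^ 2 ∂μ ≤ (2 * C) ^ 2 * ∫⁻ x, g x ^ 2 ∂μ := by
  -- S is the set of admissible bounds for the squared norm. The crude bound `a₀` serves only to
  -- make its infimum N finite; the bootstrap then gives N ≤ 2C√N.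
  set S : Set ℝ≥0∞ := {a | ∀ g : X → ℝ≥0∞, Measurable g → ∫⁻ x, g x ^ 2 ∂μ ≠ ∞ →
      ∫⁻ x, (∫⁻ t, k x t * g t ∂μ) ^ 2 ∂μ ≤ a * ∫⁻ x, g x ^ 2 ∂μ} with hS
  set a₀ : ℝ≥0∞ := B ^ 2 * μ Set.univ * μ Set.univ with ha₀
  have ha₀S : a₀ ∈ S := by
    intro g hg _
    have h1 : ∀ x, (∫⁻ t, k x t * g t ∂μ) ^ 2 ≤ B ^ 2 * μ Set.univ * ∫⁻ x, g x ^ 2 ∂μ := by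
      intro x
      refine (sq_lintegral_mul_le (hk.comp measurable_prodMk_left).aemeasurable
        hg.aemeasurable).trans ?_
      gcongr
      refine (lintegral_mono fun t => pow_le_pow_left₀ (zero_le) (hB x t) 2).trans ?_
      rw [lintegral_const]
    refine (lintegral_mono h1).trans ?_
    rw [lintegral_const]
    exact le_of_eq (by ring)
  have ha₀top : a₀ ≠ ∞ := by
    refine ENNReal.mul_ne_top (ENNReal.mul_ne_top (ENNReal.pow_ne_top hBtop) ?_) ?_ <;>
    exact measure_ne_top _ _
  set N := sInf S with hN
  have hNtop : N ≠ ∞ := ne_top_of_le_ne_top ha₀top (sInf_le ha₀S)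
  have hNS : N ∈ S := by
    intro g hg hgtop
    rcases eq_or_ne (∫⁻ x, g x ^ 2 ∂μ) 0 with h0 | h0
    · have := ha₀S g hg hgtop
      rw [h0, mul_zero] at this ⊢
      exact this
    · rw [← ENNReal.div_le_iff h0 hgtop]
      exact le_sInf fun a ha => (ENNReal.div_le_iff h0 hgtop).mpr (ha g hg hgtop)
  have hsqrt : ∀ a : ℝ≥0∞, (a ^ (1 / 2 : ℝ)) ^ 2 = a := fun a => by
    rw [← ENNReal.rpow_natCast, ← ENNReal.rpow_mul]; norm_num
  have hb : 2 * C * N ^ (1 / 2 : ℝ) ∈ S := by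
    intro g hg hgtop
    refine (ENNReal.pow_le_pow_left_iff two_ne_zero).mp ?_
    rw [mul_pow, mul_pow, hsqrt]
    exact sq_lintegral_kernel_le hk hC hNS hNtop hg hgtop
  have hNle : N ≤ (2 * C) ^ 2 := by
    have h1 : N ≤ 2 * C * N ^ (1 / 2 : ℝ) := sInf_le hb
    rcases eq_or_ne N 0 with h0 | h0
    · rw [h0]; exact zero_le
    · have h2 : N * N ≤ (2 * C) ^ 2 * N :=
        calc N * N ≤ (2 * C * N ^ (1 / 2 : ℝ)) * (2 * C * N ^ (1 / 2 : ℝ)) := by gcongr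
          _ = (2 * C) ^ 2 * (N ^ (1 / 2 : ℝ)) ^ 2 := by ring
          _ = _ := by rw [hsqrt]
      exact (ENNReal.mul_le_mul_iff_left h0 hNtop).mp h2
  exact (hNS g hg hgtop).trans (mul_le_mul_left hNle _)

end PositiveKernel

/-! ### Maximal inequalities for bump averages -/

/-- The maximal inequality for finite families of bump kernels on the circle. -/
lemma lintegral_iSup_bump_le {I : Type*} [Countable I] {A : I → ℝ} (hA : ∀ i, 0 ≤ A i)
    (s : Finset I) {g : 𝕋 → ℝ≥0∞} (hg : Measurable g) :
    ∫⁻ x, ⨆ i ∈ s, (∫⁻ t, bump (A i) (x - t) * g t) ^ 2 ≤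
      ENNReal.ofReal (8 * π) ^ 2 * ∫⁻ x, g x ^ 2 := by
  rcases s.eq_empty_or_nonempty with rfl | hs
  · simp
  rcases eq_or_ne (∫⁻ x, g x ^ 2) ∞ with hgtop | hgtop
  · rw [hgtop, ENNReal.mul_top]
    · exact le_top
    · have := Real.pi_pos
      exact pow_ne_zero 2 (by positivity)
  let _ : MeasurableSpace I := ⊤
  have _ : DiscreteMeasurableSpace I := ⟨fun _ => trivial⟩
  obtain ⟨n, hn, hns, hmax⟩ := exists_measurable_selection
    (g := fun i x => (∫⁻ t, bump (A i) (x - t) * g t) ^ 2) (fun i => by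
      have : Measurable fun x => ∫⁻ t, bump (A i) (x - t) * g t :=
        Measurable.lintegral_prod_right' (f := fun p : 𝕋 × 𝕋 => bump (A i) (p.1 - p.2) * g p.2)
          (((measurable_bump (A i)).comp (measurable_fst.sub measurable_snd)).mul
            (hg.comp measurable_snd))
      exact this.pow_const 2) s hs
  simp_rw [hmax]
  have hk : Measurable (Function.uncurry fun x t : 𝕋 => bump (A (n x)) (x - t)) :=
    (measurable_from_prod_countable_right (f := fun p : I × 𝕋 => bump (A p.1) p.2)
      fun i => measurable_bump (A i)).comp
      ((hn.comp measurable_fst).prodMk (measurable_fst.sub measurable_snd))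
  -- The selection takes values in the finite set s, so the linearized kernel is bounded. The bound
  -- B does not enter the resulting constant.
  have h := lintegral_sq_kernel_le (μ := volume) hk (C := ENNReal.ofReal (4 * π))
    (B := ∑ i ∈ s, ENNReal.ofReal (A i)) (fun x y => ?_) (fun x y => ?_)
    (by simp) hg hgtop
  · convert h using 3
    rw [show (8 * π) = 2 * (4 * π) by ring, ENNReal.ofReal_mul (by norm_num), ENNReal.ofReal_ofNat]
  · refine (lintegral_bump_mul_bump_le (hA _) (hA _) x y).trans_eq ?_
    rw [bump_sub_comm (A (n y)) x y]
  · exact (bump_le_ofReal (hA _) _).trans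
      (Finset.single_le_sum (f := fun i => ENNReal.ofReal (A i)) (fun _ _ => zero_le) (hns x))

/-- The maximal inequality for bump kernels acting in one coordinate of a torus. -/
lemma lintegral_iSup_bump_update_le {ι : Type*} [Fintype ι] [DecidableEq ι] {I : Type*}
    [Countable I] {A : I → ℝ} (hA : ∀ i, 0 ≤ A i) (s : Finset I) (j : ι) {g : (ι → 𝕋) → ℝ≥0∞}
    (hg : Measurable g) :
    ∫⁻ x, ⨆ i ∈ s, (∫⁻ t, bump (A i) (x j - t) * g (Function.update x j t)) ^ 2 ≤
      ENNReal.ofReal (8 * π) ^ 2 * ∫⁻ x, g x ^ 2 := by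
  rw [← lintegral_const_mul _ (hg.pow_const 2)]
  have hF : ∀ i, Measurable fun x : ι → 𝕋 =>
      ∫⁻ t, bump (A i) (x j - t) * g (Function.update x j t) := fun i => by
    refine Measurable.lintegral_prod_right'
      (f := fun p : (ι → 𝕋) × 𝕋 => bump (A i) (p.1 j - p.2) * g (Function.update p.1 j p.2)) ?_
    refine ((measurable_bump (A i)).comp
      (((measurable_pi_apply j).comp measurable_fst).sub measurable_snd)).mul (hg.comp ?_)
    exact measurable_update'
  refine lintegral_le_of_lmarginal_le (μ := fun _ : ι => (volume : Measure 𝕋)) {j}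
    (.biSup _ s.countable_toSet fun i _ => (hF i).pow_const 2) ((hg.pow_const 2).const_mul _) ?_
  intro x
  rw [lmarginal_singleton, lmarginal_singleton]
  simp only [Function.update_self, Function.update_idem]
  have hgx : Measurable fun t => g (Function.update x j t) := hg.comp (measurable_update x)
  rw [lintegral_const_mul _ (hgx.pow_const 2)]
  exact lintegral_iSup_bump_le hA s hgx

/-! ### Adding a lacunary coordinate -/

section LacunaryStep

section SquareFunction

variable {q : ℝ} {a : ℕ+ → ℕ+}

/-- The difference between the multipliers of the partial sum and of the Fejér mean of order `n`. -/
def fejerRemainder (n : ℕ) (κ : ℤ) : ℝ := (if |κ| ≤ n then 1 else 0) - fejerMultiplier n κ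

lemma sq_fejerRemainder_le (n : ℕ) (hn : 0 < n) (κ : ℤ) :
    fejerRemainder n κ ^ 2 ≤ if |κ| ≤ n then (|(κ : ℝ)| / n) ^ 2 else 0 := by
  unfold fejerRemainder
  have hn' : (0 : ℝ) < n := by exact_mod_cast hn
  split_ifs with h
  · rw [one_sub_fejerMultiplier h]
    gcongr
    linarith
  · rw [fejerMultiplier_of_lt (not_le.mp h)]; norm_num

/-- The sum telescopes against b_k = min(1, (|κ|/a_k)²): lacunarity shrinks (|κ|/a_k)² by a factor
q⁻² at each step, so (1 − q⁻²) times a squared remainder is at most b_k − b_{k+1}. -/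
lemma sum_sq_fejerRemainder_le (ha : IsLacunary q a) (s : Finset ℕ+) (κ : ℤ) :
    ∑ l ∈ s, fejerRemainder (a l) κ ^ 2 ≤ (1 - (q ^ 2)⁻¹)⁻¹ := by
  have hq := ha.one_lt
  have hq2 : 1 < q ^ 2 := by nlinarith
  have hδ : 0 < 1 - (q ^ 2)⁻¹ := by
    have := inv_lt_one_of_one_lt₀ hq2
    linarith
  set b : ℕ → ℝ := fun k => min 1 ((|(κ : ℝ)| / (a k.succPNat : ℕ)) ^ 2) with hb
  have hstep : ∀ k : ℕ, (1 - (q ^ 2)⁻¹) * fejerRemainder (a k.succPNat) κ ^ 2 ≤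
      b k - b (k + 1) := by
    intro k
    have hr := ha.ratio k.succPNat
    have hsucc : k.succPNat + 1 = (k + 1).succPNat := rfl
    rw [hsucc] at hr
    simp only [hb]
    set m := (a k.succPNat : ℕ)
    set m' := (a (k + 1).succPNat : ℕ)
    have hm0 : 0 < m := (a k.succPNat).pos
    have hm : (0 : ℝ) < m := by exact_mod_cast hm0
    have hm' : (0 : ℝ) < m' := by exact_mod_cast (a (k + 1).succPNat).pos
    rw [le_div_iff₀ hm] at hr
    set y := |(κ : ℝ)| with hy
    have hy0 : 0 ≤ y := abs_nonneg _
    have h1 : (y / m') ^ 2 ≤ (q ^ 2)⁻¹ * (y / m) ^ 2 := by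
      rw [inv_mul_eq_div, div_pow, div_pow, div_div]
      gcongr
      rw [← mul_pow, mul_comm]
      exact pow_le_pow_left₀ (by positivity) hr 2
    have h2 := sq_fejerRemainder_le m hm0 κ
    split_ifs at h2 with h
    · have hle : y / m ≤ 1 := by
        rw [div_le_one hm]
        have : ((|κ| : ℤ) : ℝ) ≤ m := by exact_mod_cast h
        simpa using this
      have hsq : (y / m) ^ 2 ≤ 1 := pow_le_one₀ (by positivity) hle
      rw [min_eq_right hsq]
      have := min_le_right 1 ((y / m') ^ 2)
      have := mul_le_mul_of_nonneg_left h2 hδ.le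
      linarith
    · have h3 : (y / m') ^ 2 ≤ (y / m) ^ 2 := by
        refine h1.trans ?_
        have : (q ^ 2)⁻¹ ≤ 1 := by linarith
        exact mul_le_of_le_one_left (by positivity) this
      have h4 := min_le_min_left 1 h3
      have h5 := mul_le_mul_of_nonneg_left h2 hδ.le
      linarith
  obtain ⟨n, hn⟩ : ∃ n, ∀ l ∈ s, PNat.natPred l < n :=
    ⟨(s.sup PNat.natPred) + 1, fun l hl => Nat.lt_succ_of_le (Finset.le_sup hl)⟩
  have h1 : ∑ l ∈ s, fejerRemainder (a l) κ ^ 2 ≤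
      ∑ k ∈ Finset.range n, fejerRemainder (a k.succPNat) κ ^ 2 := by
    have : ∑ l ∈ s, fejerRemainder (a l) κ ^ 2 =
        ∑ k ∈ s.image PNat.natPred, fejerRemainder (a k.succPNat) κ ^ 2 := by
      rw [Finset.sum_image PNat.natPred_injective.injOn]
      simp only [PNat.succPNat_natPred]
    rw [this]
    refine Finset.sum_le_sum_of_subset_of_nonneg ?_ fun _ _ _ => sq_nonneg _
    intro k hk
    obtain ⟨l, hl, rfl⟩ := Finset.mem_image.mp hk
    exact Finset.mem_range.mpr (hn l hl)
  refine h1.trans ?_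
  rw [← one_div, le_div_iff₀ hδ, mul_comm, Finset.mul_sum]
  refine (Finset.sum_le_sum fun k _ => hstep k).trans ?_
  rw [Finset.sum_range_sub']
  have h2 : b 0 ≤ 1 := min_le_left _ _
  have h3 : 0 ≤ b n := le_min zero_le_one (sq_nonneg _)
  linarith

end SquareFunction

variable {ι : Type*} [Fintype ι] {I : Type*}

lemma measurable_iSup_enorm_trigPoly (φ : I → (ι → ℤ) → ℝ) (s : Finset I) (Λ : Finset (ι → ℤ))
    (c : (ι → ℤ) → ℂ) :
    Measurable fun x : ι → 𝕋 => ⨆ i ∈ s, ‖∑ ν ∈ Λ, (φ i ν : ℂ) * c ν * mexp ν x‖ₑ ^ 2 := by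
  refine .biSup _ s.countable_toSet fun i _ => ?_
  have : Continuous fun x : ι → 𝕋 => ∑ ν ∈ Λ, (φ i ν : ℂ) * c ν * mexp ν x := by fun_prop
  exact this.measurable.enorm.pow_const 2

variable [DecidableEq ι]

lemma mexp_update (ν : ι → ℤ) (x : ι → 𝕋) (j : ι) (t : 𝕋) :
    mexp ν (Function.update x j t) =
      fourier (ν j) t * ∏ i ∈ Finset.univ.erase j, (fourier (ν i) (x i) : ℂ) := by
  rw [mexp, ← Finset.mul_prod_erase Finset.univ _ (Finset.mem_univ j), Function.update_self]
  congr 1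
  refine Finset.prod_congr rfl fun i hi => ?_
  rw [Function.update_of_ne (Finset.ne_of_mem_erase hi)]

/-- The Fejér multiplier in one coordinate acts on trigonometric polynomials as a convolution. -/
lemma integral_fejer_mul_trigPoly (n : ℕ) (j : ι) (Λ : Finset (ι → ℤ)) (d : (ι → ℤ) → ℂ)
    (x : ι → 𝕋) :
    ∫ t, fejer n (x j - t) * ∑ ν ∈ Λ, d ν * mexp ν (Function.update x j t) =
      (2 * π : ℝ) * ∑ ν ∈ Λ, (fejerMultiplier n (ν j) : ℂ) * d ν * mexp ν x := by
  set R : (ι → ℤ) → ℂ := fun ν => ∏ i ∈ Finset.univ.erase j, (fourier (ν i) (x i) : ℂ) with hR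
  have h1 : ∀ t, fejer n (x j - t) * ∑ ν ∈ Λ, d ν * mexp ν (Function.update x j t) =
      ∑ ν ∈ Λ, d ν * R ν * (fejer n (x j - t) * fourier (ν j) t) := by
    intro t
    simp only [mexp_update, Finset.mul_sum, hR]
    exact Finset.sum_congr rfl fun ν _ => by ring
  simp_rw [h1]
  rw [integral_finsetSum _ fun ν _ => integrable_of_continuous_circle (by fun_prop),
    Finset.mul_sum]
  refine Finset.sum_congr rfl fun ν _ => ?_
  rw [integral_const_mul, integral_fejer_mul_fourier]
  have h2 : mexp ν x = fourier (ν j) (x j) * R ν := by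
    rw [← mexp_update, Function.update_eq_self]
  rw [h2]
  push_cast
  ring

/-- The constant in the comparison of Fejér means with averages against bump kernels. -/
def fejerConstant : ℝ := (2 * π)⁻¹ * (1 + π ^ 2)

lemma enorm_sum_fejerMultiplier_le (n : ℕ) (j : ι) (Λ : Finset (ι → ℤ)) (d : (ι → ℤ) → ℂ)
    (x : ι → 𝕋) :
    ‖∑ ν ∈ Λ, (fejerMultiplier n (ν j) : ℂ) * d ν * mexp ν x‖ₑ ≤ ENNReal.ofReal fejerConstant *
      ∫⁻ t, bump (n + 1) (x j - t) * ‖∑ ν ∈ Λ, d ν * mexp ν (Function.update x j t)‖ₑ := by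
  have h := integral_fejer_mul_trigPoly n j Λ d x
  have hp := Real.pi_pos
  have h1 : ∑ ν ∈ Λ, (fejerMultiplier n (ν j) : ℂ) * d ν * mexp ν x = ((2 * π)⁻¹ : ℝ) *
      ∫ t, fejer n (x j - t) * ∑ ν ∈ Λ, d ν * mexp ν (Function.update x j t) := by
    rw [h, ← mul_assoc, ← Complex.ofReal_mul, inv_mul_cancel₀ (by positivity), Complex.ofReal_one,
      one_mul]
  have h2 : ‖(((2 * π)⁻¹ : ℝ) : ℂ)‖ₑ = ENNReal.ofReal (2 * π)⁻¹ := by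
    rw [← ofReal_norm, Complex.norm_real, Real.norm_of_nonneg (by positivity)]
  rw [h1, enorm_mul, h2, fejerConstant, ENNReal.ofReal_mul (by positivity), mul_assoc]
  refine mul_le_mul_right ?_ _
  refine (enorm_integral_le_lintegral_enorm _).trans ?_
  rw [← lintegral_const_mul']
  · refine lintegral_mono fun t => ?_
    rw [enorm_mul, ← mul_assoc]
    exact mul_le_mul_left (enorm_fejer_le n _) _
  · exact ENNReal.ofReal_ne_top

lemma enorm_add_sq_le (z w : ℂ) : ‖z + w‖ₑ ^ 2 ≤ 2 * ‖z‖ₑ ^ 2 + 2 * ‖w‖ₑ ^ 2 := by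
  simp only [enorm_sq_eq_ofReal]
  rw [show (2 : ℝ≥0∞) = ENNReal.ofReal 2 by simp, ← ENNReal.ofReal_mul (by norm_num),
    ← ENNReal.ofReal_mul (by norm_num), ← ENNReal.ofReal_add (by positivity) (by positivity)]
  refine ENNReal.ofReal_le_ofReal ?_
  have h1 := pow_le_pow_left₀ (norm_nonneg _) (norm_add_le z w) 2
  nlinarith [sq_nonneg (‖z‖ - ‖w‖)]

/-- The squared norm of the lacunary maximal operator in one coordinate is at most this. -/
def lacunaryConstant (q : ℝ) : ℝ≥0∞ :=
  2 * (ENNReal.ofReal fejerConstant ^ 2 * ENNReal.ofReal (8 * π) ^ 2) +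
    2 * ENNReal.ofReal (1 - (q ^ 2)⁻¹)⁻¹

/-- A maximal inequality is preserved when lacunary partial sums in one coordinate are added. -/
lemma MaximalBound.lacunary {φ : I → (ι → ℤ) → ℝ} {A : ℝ≥0∞} (hφ : MaximalBound φ A) (j : ι)
    {q : ℝ} {a : ℕ+ → ℕ+} (ha : IsLacunary q a) :
    MaximalBound (fun (p : I × ℕ+) ν => φ p.1 ν * if |ν j| ≤ (a p.2 : ℕ) then 1 else 0)
      (lacunaryConstant q * A) := by
  classical
  intro s Λ c
  set s₁ := s.image Prod.fst
  set s₂ := s.image Prod.snd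
  -- For the remainders the supremum over l is replaced by a sum of squares; each summand is the
  -- hypothesis applied to the coefficients multiplied by the remainder.
  set V : ℕ+ → (ι → 𝕋) → ℝ≥0∞ := fun l x => ⨆ i ∈ s₁,
    ‖∑ ν ∈ Λ, (φ i ν : ℂ) * ((fejerRemainder (a l) (ν j) : ℂ) * c ν) * mexp ν x‖ₑ ^ 2 with hV
  have hVm : ∀ l, Measurable (V l) := fun l =>
    measurable_iSup_enorm_trigPoly φ s₁ Λ fun ν => (fejerRemainder (a l) (ν j) : ℂ) * c ν
  -- The supremum over i is taken before averaging in the coordinate j. Positivity of the bump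
  -- kernels then lets one function g dominate all Fejér means.
  set g : (ι → 𝕋) → ℝ≥0∞ := fun x =>
    (⨆ i ∈ s₁, ‖∑ ν ∈ Λ, (φ i ν : ℂ) * c ν * mexp ν x‖ₑ ^ 2) ^ (1 / 2 : ℝ) with hg
  have hgm : Measurable g := (measurable_iSup_enorm_trigPoly φ s₁ Λ c).pow_const _
  have hg2 : ∀ x, g x ^ 2 = ⨆ i ∈ s₁, ‖∑ ν ∈ Λ, (φ i ν : ℂ) * c ν * mexp ν x‖ₑ ^ 2 := fun x => by
    rw [hg, ← ENNReal.rpow_natCast, ← ENNReal.rpow_mul]; norm_num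
  have hle : ∀ i ∈ s₁, ∀ x, ‖∑ ν ∈ Λ, (φ i ν : ℂ) * c ν * mexp ν x‖ₑ ≤ g x := fun i hi x => by
    refine (ENNReal.pow_le_pow_left_iff two_ne_zero).mp ?_
    rw [hg2]
    exact le_iSup₂ (f := fun i _ => ‖∑ ν ∈ Λ, (φ i ν : ℂ) * c ν * mexp ν x‖ₑ ^ 2) i hi
  set U : (ι → 𝕋) → ℝ≥0∞ := fun x => ⨆ l ∈ s₂,
    (∫⁻ t, bump ((a l : ℕ) + 1) (x j - t) * g (Function.update x j t)) ^ 2 with hU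
  set K := ENNReal.ofReal fejerConstant
  have hpt : ∀ x, ⨆ p ∈ s, ‖∑ ν ∈ Λ, ((φ p.1 ν * (if |ν j| ≤ (a p.2 : ℕ) then 1 else 0) : ℝ) : ℂ) *
      c ν * mexp ν x‖ₑ ^ 2 ≤ 2 * ∑ l ∈ s₂, V l x + 2 * K ^ 2 * U x := by
    intro x
    refine iSup₂_le ?_
    rintro ⟨i, l⟩ hp
    have hi : i ∈ s₁ := Finset.mem_image_of_mem _ hp
    have hl : l ∈ s₂ := Finset.mem_image_of_mem _ hp
    have hsplit : ∑ ν ∈ Λ, ((φ i ν * (if |ν j| ≤ (a l : ℕ) then 1 else 0) : ℝ) : ℂ) *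
        c ν * mexp ν x =
        ∑ ν ∈ Λ, (φ i ν : ℂ) * ((fejerRemainder (a l) (ν j) : ℂ) * c ν) * mexp ν x +
        ∑ ν ∈ Λ, (fejerMultiplier (a l) (ν j) : ℂ) * ((φ i ν : ℂ) * c ν) * mexp ν x := by
      rw [← Finset.sum_add_distrib]
      refine Finset.sum_congr rfl fun ν _ => ?_
      rw [fejerRemainder]
      push_cast
      ring
    simp only [hsplit]
    refine (enorm_add_sq_le _ _).trans (add_le_add ?_ ?_)
    · refine mul_le_mul_right ?_ _
      refine le_trans ?_ (Finset.single_le_sum (f := fun l => V l x) (fun _ _ => zero_le) hl)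
      exact le_iSup₂ (f := fun i _ => ‖∑ ν ∈ Λ, (φ i ν : ℂ) *
        ((fejerRemainder (a l) (ν j) : ℂ) * c ν) * mexp ν x‖ₑ ^ 2) i hi
    · rw [mul_assoc]
      refine mul_le_mul_right ?_ _
      have h1 := enorm_sum_fejerMultiplier_le (a l) j Λ (fun ν => (φ i ν : ℂ) * c ν) x
      have h2 : ∫⁻ t, bump ((a l : ℕ) + 1) (x j - t) *
          ‖∑ ν ∈ Λ, (φ i ν : ℂ) * c ν * mexp ν (Function.update x j t)‖ₑ ≤
          ∫⁻ t, bump ((a l : ℕ) + 1) (x j - t) * g (Function.update x j t) :=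
        lintegral_mono fun t => mul_le_mul_right (hle i hi _) _
      have h3 := pow_le_pow_left₀ zero_le (h1.trans (mul_le_mul_right h2 _)) 2
      rw [mul_pow] at h3
      refine h3.trans (mul_le_mul_right ?_ _)
      exact le_iSup₂ (f := fun l _ => (∫⁻ t, bump ((a l : ℕ) + 1) (x j - t) *
        g (Function.update x j t)) ^ 2) l hl
  set S := ∑ ν ∈ Λ, ‖c ν‖ₑ ^ 2 with hS
  have hUint : ∫⁻ x, U x ≤ ENNReal.ofReal (8 * π) ^ 2 * (A * S) := by
    refine (lintegral_iSup_bump_update_le (A := fun l : ℕ+ => ((a l : ℕ) : ℝ) + 1)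
      (fun l => by positivity) s₂ j hgm).trans (mul_le_mul_right ?_ _)
    simp_rw [hg2]
    exact hφ s₁ Λ c
  have hVint : ∫⁻ x, ∑ l ∈ s₂, V l x ≤ A * (ENNReal.ofReal (1 - (q ^ 2)⁻¹)⁻¹ * S) := by
    rw [lintegral_finsetSum _ fun l _ => hVm l]
    have hl : ∀ l ∈ s₂, ∫⁻ x, V l x ≤ A * ∑ ν ∈ Λ, ‖(fejerRemainder (a l) (ν j) : ℂ) * c ν‖ₑ ^ 2 :=
      fun l _ => hφ s₁ Λ fun ν => (fejerRemainder (a l) (ν j) : ℂ) * c ν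
    refine (Finset.sum_le_sum hl).trans ?_
    rw [← Finset.mul_sum, Finset.sum_comm]
    refine mul_le_mul_right ?_ _
    rw [hS, Finset.mul_sum]
    refine Finset.sum_le_sum fun ν _ => ?_
    simp only [enorm_mul, mul_pow]
    rw [← Finset.sum_mul]
    refine mul_le_mul_left ?_ _
    simp only [enorm_sq_eq_ofReal, Complex.norm_real, Real.norm_eq_abs, sq_abs]
    rw [← ENNReal.ofReal_sum_of_nonneg fun _ _ => sq_nonneg _]
    exact ENNReal.ofReal_le_ofReal (sum_sq_fejerRemainder_le ha s₂ (ν j))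
  have hsm : Measurable fun x => ∑ l ∈ s₂, V l x := Finset.measurable_fun_sum _ fun l _ => hVm l
  calc _ ≤ ∫⁻ x, (2 * ∑ l ∈ s₂, V l x + 2 * K ^ 2 * U x) := lintegral_mono hpt
    _ = 2 * (∫⁻ x, ∑ l ∈ s₂, V l x) + 2 * K ^ 2 * ∫⁻ x, U x := by
        rw [lintegral_add_left (hsm.const_mul 2), lintegral_const_mul _ hsm,
          lintegral_const_mul' _ _
            (ENNReal.mul_ne_top ENNReal.ofNat_ne_top (ENNReal.pow_ne_top ENNReal.ofReal_ne_top))]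
    _ ≤ 2 * (A * (ENNReal.ofReal (1 - (q ^ 2)⁻¹)⁻¹ * S)) +
        2 * K ^ 2 * (ENNReal.ofReal (8 * π) ^ 2 * (A * S)) := by gcongr
    _ = lacunaryConstant q * A * S := by rw [lacunaryConstant]; ring

end LacunaryStep

/-! ### Reindexing and extension to more coordinates -/

section MaximalBound

variable {ι : Type*} [Fintype ι] {I : Type*}

lemma MaximalBound.comp {φ : I → (ι → ℤ) → ℝ} {A : ℝ≥0∞} (hφ : MaximalBound φ A) {I' : Type*}
    (r : I' → I) : MaximalBound (fun i => φ (r i)) A := by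
  classical
  intro s Λ c
  refine (lintegral_mono fun x => ?_).trans (hφ (s.image r) Λ c)
  refine iSup₂_le fun i hi => ?_
  exact le_iSup₂ (f := fun i _ => ‖∑ ν ∈ Λ, (φ i ν : ℂ) * c ν * mexp ν x‖ₑ ^ 2) (r i)
    (Finset.mem_image_of_mem r hi)

/-- A maximal inequality in some of the coordinates holds on the full torus. -/
lemma MaximalBound.of_subtype {p : ι → Prop} [DecidablePred p] {φ : I → ({j // p j} → ℤ) → ℝ}
    {A : ℝ≥0∞} (hφ : MaximalBound φ A) (hA : A ≠ ∞) :
    MaximalBound (fun i (ν : ι → ℤ) => φ i fun j => ν j)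
      (A * ENNReal.ofReal ((2 * π) ^ Fintype.card {j // ¬ p j})) := by
  classical
  intro s Λ c
  set F : (ι → 𝕋) → ℝ≥0∞ := fun x => ⨆ i ∈ s,
    ‖∑ ν ∈ Λ, ((φ i fun j => ν j : ℝ) : ℂ) * c ν * mexp ν x‖ₑ ^ 2 with hF
  have hFm : Measurable F :=
    measurable_iSup_enorm_trigPoly (fun i (ν : ι → ℤ) => φ i fun j => ν j) s Λ c
  set e := MeasurableEquiv.piEquivPiSubtypeProd (fun _ : ι => 𝕋) p with he
  have hmp := (volume_preserving_piEquivPiSubtypeProd (fun _ : ι => 𝕋) p).symm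
  set ρ : (ι → ℤ) → {j // p j} → ℤ := fun ν j => ν j with hρ
  set Λ₁ : Finset ({j // p j} → ℤ) := Λ.image ρ with hΛ₁
  have hmaps : ∀ ν ∈ Λ, ρ ν ∈ Λ₁ := fun ν hν => Finset.mem_image_of_mem ρ hν
  set Λ₂ : ({j // p j} → ℤ) → Finset (ι → ℤ) := fun κ => Λ.filter fun ν => ρ ν = κ
    with hΛ₂
  -- With the remaining variables z frozen, the polynomial is one in the selected variables with
  -- these coefficients. Parseval in z recovers the original coefficients, since restriction to the
  -- remaining coordinates is injective on each fiber of `ρ`.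
  set d : ({j // ¬ p j} → 𝕋) → ({j // p j} → ℤ) → ℂ := fun z κ =>
    ∑ ν ∈ Λ₂ κ, c ν * mexp (fun j : {j // ¬ p j} => ν j) z with hd
  have hexp : ∀ (ν : ι → ℤ) y z, mexp ν (e.symm (y, z)) =
      mexp (fun j : {j // p j} => ν j) y * mexp (fun j : {j // ¬ p j} => ν j) z := by
    intro ν y z
    have h1 : ∀ j : {j // p j}, e.symm (y, z) j = y j := fun j => by
      simp [he, MeasurableEquiv.piEquivPiSubtypeProd, Equiv.piEquivPiSubtypeProd, j.2]
    have h2 : ∀ j : {j // ¬ p j}, e.symm (y, z) j = z j := fun j => by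
      simp [he, MeasurableEquiv.piEquivPiSubtypeProd, Equiv.piEquivPiSubtypeProd, j.2]
    unfold mexp
    rw [← Fintype.prod_subtype_mul_prod_subtype p]
    simp only [h1, h2]
  have hslice : ∀ y z, F (e.symm (y, z)) =
      ⨆ i ∈ s, ‖∑ κ ∈ Λ₁, (φ i κ : ℂ) * d z κ * mexp κ y‖ₑ ^ 2 := by
    intro y z
    simp only [hF]
    refine iSup_congr fun i => iSup_congr fun _ => ?_
    congr 2
    rw [← Finset.sum_fiberwise_of_maps_to hmaps]
    refine Finset.sum_congr rfl fun κ _ => ?_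
    simp only [hd, Finset.mul_sum, Finset.sum_mul]
    refine Finset.sum_congr rfl fun ν hν => ?_
    rw [hexp, ← (Finset.mem_filter.mp hν).2]
    ring
  have hdm : ∀ κ, Measurable fun z => ‖d z κ‖ₑ ^ 2 := fun κ => by
    have : Continuous fun z => d z κ := by
      simp only [hd]
      fun_prop
    exact this.measurable.enorm.pow_const 2
  have hdint : ∀ κ, ∫⁻ z, ‖d z κ‖ₑ ^ 2 =
      ENNReal.ofReal ((2 * π) ^ Fintype.card {j // ¬ p j}) * ∑ ν ∈ Λ₂ κ, ‖c ν‖ₑ ^ 2 := by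
    intro κ
    refine lintegral_trigPoly (Λ₂ κ) (r := fun ν (j : {j // ¬ p j}) => ν j) ?_ c
    intro ν hν ν' hν' h
    have h1 := ((Finset.mem_filter.mp hν).2).trans (Finset.mem_filter.mp hν').2.symm
    funext j
    by_cases hj : p j
    · exact congrFun h1 ⟨j, hj⟩
    · exact congrFun h ⟨j, hj⟩
  calc ∫⁻ x, F x = ∫⁻ w, F (e.symm w) := (hmp.lintegral_comp hFm).symm
    _ = ∫⁻ z, ∫⁻ y, F (e.symm (y, z)) := by
        rw [Measure.volume_eq_prod,
          lintegral_prod_symm (fun w => F (e.symm w)) (hFm.comp e.symm.measurable).aemeasurable]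
    _ ≤ ∫⁻ z, A * ∑ κ ∈ Λ₁, ‖d z κ‖ₑ ^ 2 := by
        refine lintegral_mono fun z => ?_
        simp_rw [hslice]
        exact hφ s Λ₁ (d z)
    _ = A * ∑ κ ∈ Λ₁, ∫⁻ z, ‖d z κ‖ₑ ^ 2 := by
        rw [lintegral_const_mul' _ _ hA, lintegral_finsetSum _ fun κ _ => hdm κ]
    _ = _ := by
        simp_rw [hdint]
        rw [← Finset.mul_sum, Finset.sum_fiberwise_of_maps_to hmaps, mul_assoc]

end MaximalBound

/-! ### Induction over the lacunary coordinates and passage to L² functions -/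

section PartialSums

variable {N : ℕ}

lemma expo_eq_mexp (ν : Fin N → ℤ) : expo ν = mexp ν := rfl

/-- Bessel's inequality. -/
lemma sum_enorm_coeff_sq_le {f : Torus N → ℂ} (hf : MemLp f 2 volume) (Λ : Finset (Fin N → ℤ)) :
    ENNReal.ofReal ((2 * π) ^ N) * ∑ ν ∈ Λ, ‖coeff f ν‖ₑ ^ 2 ≤ ∫⁻ x, ‖f x‖ₑ ^ 2 := by
  have hp := Real.pi_pos
  set P : Torus N → ℂ := fun x => ∑ ν ∈ Λ, coeff f ν * mexp ν x with hP
  have hPc : Continuous P := by fun_prop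
  have hpars : ∫⁻ x, ‖P x‖ₑ ^ 2 =
      ENNReal.ofReal ((2 * π) ^ N) * ∑ ν ∈ Λ, ‖coeff f ν‖ₑ ^ 2 := by
    have := lintegral_trigPoly Λ (r := fun ν : Fin N → ℤ => ν) (Set.injOn_id _) (coeff f)
    rwa [Fintype.card_fin] at this
  rw [← hpars]
  set X := ∫⁻ x, ‖P x‖ₑ ^ 2 with hX
  have hfi : Integrable f := hf.integrable (by norm_num)
  have hint : ∫ x, f x * starRingEnd ℂ (P x) =
      (((2 * π) ^ N * ∑ ν ∈ Λ, ‖coeff f ν‖ ^ 2 : ℝ) : ℂ) := by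
    have h1 : ∀ x, f x * starRingEnd ℂ (P x) =
        ∑ ν ∈ Λ, starRingEnd ℂ (coeff f ν) * (f x * expo (-ν) x) := by
      intro x
      simp only [hP, map_sum, map_mul, Finset.mul_sum, expo_eq_mexp, mexp_neg]
      exact Finset.sum_congr rfl fun ν _ => by ring
    simp_rw [h1]
    rw [integral_finsetSum]
    · rw [Complex.ofReal_mul, Complex.ofReal_sum, Finset.mul_sum]
      refine Finset.sum_congr rfl fun ν _ => ?_
      rw [integral_const_mul]
      have h2 : ∫ x, f x * expo (-ν) x = ((2 * π) ^ N : ℝ) * coeff f ν := by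
        rw [coeff, ← mul_assoc, ← Complex.ofReal_mul, mul_inv_cancel₀ (by positivity),
          Complex.ofReal_one, one_mul]
      rw [h2, Complex.ofReal_pow ‖_‖, ← Complex.conj_mul']
      ring
    · intro ν _
      refine Integrable.const_mul ?_ _
      exact hfi.mul_bdd (c := 1) (continuous_mexp (-ν)).aestronglyMeasurable
        (Filter.Eventually.of_forall fun x => (norm_mexp (-ν) x).le)
  -- P is the orthogonal projection of f onto the frequencies in Λ, so ∫ f P̄ = ∫ |P|².
  -- Cauchy–Schwarz then gives X² ≤ ‖f‖² X, and X is finite.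
  have hXle : X ≤ ∫⁻ x, ‖f x‖ₑ * ‖P x‖ₑ := by
    have h1 : X = ‖∫ x, f x * starRingEnd ℂ (P x)‖ₑ := by
      rw [hint, hpars, ← ofReal_norm, Complex.norm_real, Real.norm_of_nonneg (by positivity),
        ENNReal.ofReal_mul (by positivity), ENNReal.ofReal_sum_of_nonneg fun _ _ => by positivity]
      simp only [enorm_sq_eq_ofReal]
    rw [h1]
    refine (enorm_integral_le_lintegral_enorm _).trans (lintegral_mono fun x => ?_)
    rw [enorm_mul, RCLike.enorm_conj]
  have hsq : X * X ≤ (∫⁻ x, ‖f x‖ₑ ^ 2) * X := by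
    rw [← sq]
    exact (pow_le_pow_left₀ zero_le hXle 2).trans
      (sq_lintegral_mul_le hf.aestronglyMeasurable.enorm hPc.measurable.enorm.aemeasurable)
  have hXtop : X ≠ ∞ := by
    rw [hpars]
    refine ENNReal.mul_ne_top ENNReal.ofReal_ne_top (ENNReal.sum_ne_top.mpr fun ν _ => ?_)
    exact ENNReal.pow_ne_top enorm_ne_top
  rcases eq_or_ne X 0 with h0 | h0
  · rw [h0]; exact zero_le
  · exact (ENNReal.mul_le_mul_iff_left h0 hXtop).mp hsq

/-- The multipliers of the partial sums that are lacunary in the coordinates of `S` and free outside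
`J`. -/
def mixedMultiplier (J : Finset (Fin N)) (a : J → ℕ+ → ℕ+) (S : Finset J)
    (i : (J → ℕ+) × ({j : Fin N // j ∉ J} → ℕ+)) (ν : Fin N → ℤ) : ℝ :=
  boxMultiplier (fun j => (i.2 j : ℕ)) (fun j : {j // j ∉ J} => ν j) *
    ∏ j ∈ S, if |ν j| ≤ (a j (i.1 j) : ℕ) then 1 else 0

/-- The maximal inequality for multipliers that are lacunary in the coordinates of `S`. -/
lemma maximalBound_mixedMultiplier (J : Finset (Fin N)) (q : J → ℝ) {a : J → ℕ+ → ℕ+}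
    (ha : ∀ j, IsLacunary (q j) (a j)) (S : Finset J) :
    MaximalBound (mixedMultiplier J a S)
      ((∏ j ∈ S, lacunaryConstant (q j)) *
        (ENNReal.ofReal ((8 * π) ^ Fintype.card {j // j ∉ J}) *
          ENNReal.ofReal ((2 * π) ^ Fintype.card {j // ¬ j ∉ J}))) := by
  induction S using Finset.induction_on with
  | empty =>
    simp only [Finset.prod_empty, one_mul]
    have h := ((maximalBound_boxMultiplier fun (m : {j : Fin N // j ∉ J} → ℕ+) j =>
      (m j : ℕ)).of_subtype ENNReal.ofReal_ne_top).comp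
        (Prod.snd : (J → ℕ+) × ({j : Fin N // j ∉ J} → ℕ+) → _)
    convert h using 3
    simp [mixedMultiplier]
  | insert j S hj ih =>
    have h := (ih.lacunary (j : Fin N) (ha j)).comp
      fun i : (J → ℕ+) × ({j : Fin N // j ∉ J} → ℕ+) => (i, i.1 j)
    rw [Finset.prod_insert hj, mul_assoc]
    convert h using 3
    rw [mixedMultiplier, mixedMultiplier, Finset.prod_insert hj]
    ring

/-- The constant of the maximal inequality, for the squared norms. -/
def mixedConstant (J : Finset (Fin N)) (q : J → ℝ) : ℝ≥0∞ :=
  (∏ j, lacunaryConstant (q j)) * (ENNReal.ofReal ((8 * π) ^ Fintype.card {j // j ∉ J}) *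
    ENNReal.ofReal ((2 * π) ^ Fintype.card {j // ¬ j ∉ J}))

lemma mixedConstant_ne_top (J : Finset (Fin N)) (q : J → ℝ) : mixedConstant J q ≠ ∞ := by
  refine ENNReal.mul_ne_top (ENNReal.prod_ne_top fun j _ => ?_)
    (ENNReal.mul_ne_top ENNReal.ofReal_ne_top ENNReal.ofReal_ne_top)
  refine ENNReal.add_ne_top.mpr ⟨ENNReal.mul_ne_top ENNReal.ofNat_ne_top (ENNReal.mul_ne_top
    (ENNReal.pow_ne_top ENNReal.ofReal_ne_top) (ENNReal.pow_ne_top ENNReal.ofReal_ne_top)),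
    ENNReal.mul_ne_top ENNReal.ofNat_ne_top ENNReal.ofReal_ne_top⟩

variable {J : Finset (Fin N)} {a : J → ℕ+ → ℕ+}

lemma mixedMultiplier_univ (i : (J → ℕ+) × ({j : Fin N // j ∉ J} → ℕ+)) (ν : Fin N → ℤ) :
    mixedMultiplier J a Finset.univ i ν =
      if ν ∈ box (index J a i.1 i.2) then (√(weight i.2))⁻¹ else 0 := by
  have hw : logWeight (fun j => (i.2 j : ℕ)) = weight i.2 := rfl
  have hbox : ν ∈ box (index J a i.1 i.2) ↔
      (fun j : {j // j ∉ J} => ν j) ∈ box (fun j => (i.2 j : ℕ)) ∧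
        ∀ j : J, |ν j| ≤ (a j (i.1 j) : ℕ) := by
    simp only [box, Fintype.mem_piFinset, Finset.mem_Icc, ← abs_le]
    constructor
    · intro h
      refine ⟨fun j => ?_, fun j => ?_⟩
      · have := h j
        rwa [index, dif_neg j.2] at this
      · have := h j
        rwa [index, dif_pos j.2] at this
    · rintro ⟨h1, h2⟩ j
      by_cases hj : j ∈ J
      · rw [index, dif_pos hj]; exact h2 ⟨j, hj⟩
      · rw [index, dif_neg hj]; exact h1 ⟨j, hj⟩
  rw [mixedMultiplier, boxMultiplier, hw, Finset.prod_ite_zero]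
  by_cases h1 : (fun j : {j // j ∉ J} => ν j) ∈ box (fun j => (i.2 j : ℕ)) <;>
  by_cases h2 : ∀ j : J, |ν j| ≤ (a j (i.1 j) : ℕ) <;>
  simp [hbox, h1, h2]

lemma enorm_partialSum_div (f : Torus N → ℂ) (x : Torus N)
    (i : (J → ℕ+) × ({j : Fin N // j ∉ J} → ℕ+)) {Λ : Finset (Fin N → ℤ)}
    (hΛ : box (index J a i.1 i.2) ⊆ Λ) :
    ENNReal.ofReal (‖partialSum (index J a i.1 i.2) f x‖ / √(weight i.2)) =
      ‖∑ ν ∈ Λ, (mixedMultiplier J a Finset.univ i ν : ℂ) * coeff f ν * mexp ν x‖ₑ := by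
  have h1 : ∑ ν ∈ Λ, (mixedMultiplier J a Finset.univ i ν : ℂ) * coeff f ν * mexp ν x =
      ((√(weight i.2))⁻¹ : ℝ) * partialSum (index J a i.1 i.2) f x := by
    rw [← Finset.sum_subset hΛ, partialSum, Finset.mul_sum]
    · refine Finset.sum_congr rfl fun ν hν => ?_
      rw [mixedMultiplier_univ, if_pos (show ν ∈ box _ from hν), expo_eq_mexp, mul_assoc]
    · intro ν _ hν
      rw [mixedMultiplier_univ, if_neg hν]; simp
  rw [h1, ← ofReal_norm, norm_mul, Complex.norm_real, Real.norm_of_nonneg (by positivity),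
    div_eq_inv_mul]

lemma measurable_partialSum (n : Fin N → ℕ) (f : Torus N → ℂ) : Measurable (partialSum n f) := by
  have : Continuous fun x => partialSum n f x := by
    unfold partialSum
    simp only [expo_eq_mexp]
    fun_prop
  exact this.measurable

/-- The maximal inequality for the squared norms. -/
lemma lintegral_maximal_sq_le {q : J → ℝ} (ha : ∀ j, IsLacunary (q j) (a j)) {f : Torus N → ℂ}
    (hf : MemLp f 2 volume) :
    ∫⁻ x, maximal J a f x ^ 2 ≤ mixedConstant J q *
      ((ENNReal.ofReal ((2 * π) ^ N))⁻¹ * ∫⁻ x, ‖f x‖ₑ ^ 2) := by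
  classical
  set T : (J → ℕ+) × ({j : Fin N // j ∉ J} → ℕ+) → Torus N → ℝ≥0∞ := fun i x =>
    ENNReal.ofReal (‖partialSum (index J a i.1 i.2) f x‖ / √(weight i.2)) ^ 2 with hT
  have hTm : ∀ i, Measurable (T i) := fun i =>
    (((measurable_partialSum _ f).norm.div_const _).ennreal_ofReal).pow_const 2
  have hmax : ∀ x, maximal J a f x ^ 2 =
      ⨆ s : Finset ((J → ℕ+) × ({j : Fin N // j ∉ J} → ℕ+)), ⨆ i ∈ s, T i x := by
    intro x
    rw [← iSup_eq_iSup_finset, iSup_prod, maximal]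
    simp only [hT, ENNReal.iSup_pow]
  simp_rw [hmax]
  -- Monotone convergence along finite index sets reduces the claim to the finite suprema of
  -- `MaximalBound`, whose constant does not depend on s.
  rw [lintegral_iSup_directed
    (f := fun (s : Finset ((J → ℕ+) × ({j : Fin N // j ∉ J} → ℕ+))) x => ⨆ i ∈ s, T i x)
    (fun s => (Measurable.biSup _ s.countable_toSet fun i _ => hTm i).aemeasurable)
    (directed_of_isDirected_le fun s t hst x => biSup_mono fun i hi => Finset.mem_of_subset hst hi)]
  refine iSup_le fun s => ?_
  set Λ := s.biUnion fun i => box (index J a i.1 i.2) with hΛ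
  have h1 : ∀ x, ⨆ i ∈ s, T i x = ⨆ i ∈ s,
      ‖∑ ν ∈ Λ, (mixedMultiplier J a Finset.univ i ν : ℂ) * coeff f ν * mexp ν x‖ₑ ^ 2 := by
    intro x
    refine iSup_congr fun i => iSup_congr fun hi => ?_
    simp only [hT]
    rw [enorm_partialSum_div f x i
      (Finset.subset_biUnion_of_mem (fun i : (J → ℕ+) × ({j : Fin N // j ∉ J} → ℕ+) =>
        box (index J a i.1 i.2)) hi)]
  simp_rw [h1]
  refine (maximalBound_mixedMultiplier J q ha Finset.univ s Λ (coeff f)).trans ?_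
  refine mul_le_mul_right ?_ _
  have hp : 0 < (2 * π) ^ N := by positivity
  rw [← ENNReal.div_eq_inv_mul, ENNReal.le_div_iff_mul_le
    (Or.inl (ENNReal.ofReal_pos.mpr hp).ne') (Or.inl ENNReal.ofReal_ne_top), mul_comm]
  exact sum_enorm_coeff_sq_le hf Λ

lemma sq_eLpNorm_two {α E : Type*} [MeasurableSpace α] {μ : Measure α} [TopologicalSpace E]
    [ContinuousENorm E] (f : α → E) : eLpNorm f 2 μ ^ 2 = ∫⁻ x, ‖f x‖ₑ ^ 2 ∂μ := by
  have h := eLpNorm_nnreal_pow_eq_lintegral (μ := μ) (f := f) (p := 2) two_ne_zero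
  simpa using h

end PartialSums

end LacunaryFourier

end
theorem theorem1 (N k : ℕ) (hN : 3 ≤ N) (hk : 1 ≤ k) (hkN : k ≤ N - 2)
    (J : Finset (Fin N)) (hJ : J.card = k) (q : J → ℝ) (hq : ∀ j, 1 < q j) :
    ∃ C : ℝ, 0 < C ∧
      ∀ a : J → ℕ+ → ℕ+, (∀ j, LacunaryFourier.IsLacunary (q j) (a j)) →
        ∀ f : LacunaryFourier.Torus N → ℂ, MemLp f 2 volume →
          eLpNorm (LacunaryFourier.maximal J a f) 2 volume ≤
            ENNReal.ofReal C * eLpNorm f 2 volume := by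
  set D : ℝ≥0∞ := LacunaryFourier.mixedConstant J q * (ENNReal.ofReal ((2 * π) ^ N))⁻¹ with hD
  have hp : 0 < (2 * π) ^ N := by positivity
  have hDtop : D ≠ ∞ := ENNReal.mul_ne_top (LacunaryFourier.mixedConstant_ne_top J q)
    (ENNReal.inv_ne_top.mpr (ENNReal.ofReal_pos.mpr hp).ne')
  -- D bounds the squared norms, and D ≤ (D + 1)² avoids a square root while keeping the constant
  -- positive.
  refine ⟨D.toReal + 1, by positivity, fun a ha f hf => ?_⟩
  refine (ENNReal.pow_le_pow_left_iff two_ne_zero).mp ?_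
  rw [mul_pow, LacunaryFourier.sq_eLpNorm_two, LacunaryFourier.sq_eLpNorm_two]
  simp only [enorm_eq_self]
  refine (LacunaryFourier.lintegral_maximal_sq_le ha hf).trans ?_
  rw [← mul_assoc, ← hD]
  refine mul_le_mul_left ?_ _
  rw [← ENNReal.ofReal_pow (by positivity), ← ENNReal.ofReal_toReal hDtop]
  refine ENNReal.ofReal_le_ofReal ?_
  rw [ENNReal.toReal_ofReal ENNReal.toReal_nonneg]
  nlinarith [ENNReal.toReal_nonneg (a := D)]
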